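/- All graphs are finite, undirected and loopless, and may have multiple edges; logarithms are binary. A graph $H$ is a minor of a graph $G$ if $H$ can be obtained from $G$ by vertex removals, edge removals and edge contractions. For $r\in\mathbb{N}$ let $\theta_r$ be the graph with two vertices and $r$ parallel edges between them, and let $k\cdot\theta_r$ be the disjoint union of $k$ copies of $\theta_r$. Let $\mathrm{tw}(G)$ be the treewidth of $G$, that is, the minimum over all tree-decompositions of $G$ of the maximum size of a bag, minus one. (1) For every graph $G$ and all integers $r\ge 2$ and $k\ge 1$, if $\mathrm{tw}(G)\ \ge\ 2^{6r}\cdot k\cdot\log_2(k+1)$, then $G$ contains $k\cdot\theta_r$ as a minor. (2) Consequently, for every fixed $r$, graphs excluding $k\cdot\theta_r$ as a minor have treewidth $O(k\log k)$: for every $r\in\mathbb{N}$ there is a function $c:\mathbb{N}\to\mathbb{R}$ with $c(k)=O(k\log k)$ as $k\to\infty$ such that, for every $k$, every graph $G$ that does not contain $k\cdot\theta_r$ as a minor satisfies $\mathrm{tw}(G)\le c(k)$. -/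

import Mathlib

namespace Graph

/-- A multigraph is connected if it has a vertex and any two of its vertices are joined by a
sequence of consecutively adjacent vertices. -/
def IsConnected {α β : Type*} (G : Graph α β) : Prop :=
  G.vertexSet.Nonempty ∧
    ∀ x ∈ G.vertexSet, ∀ y ∈ G.vertexSet, Relation.ReflTransGen G.Adj x y

/-- `H.IsMinor G`: the multigraph `H` is a minor of the multigraph `G`, i.e. `H` is obtained (up to
isomorphism) from a subgraph of `G` by contracting pairwise disjoint connected subgraphs
`branch v`, one for each vertex `v` of `H`, to single vertices. The edges of `H` correspond to
distinct edges of `G` that are not contracted and join the branch subgraphs of their ends. -/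
def IsMinor {γ δ α β : Type*} (H : Graph γ δ) (G : Graph α β) : Prop :=
  ∃ (branch : γ → Graph α β) (edge : H.edgeSet → β),
    (∀ v ∈ H.vertexSet, branch v ≤ G ∧ (branch v).IsConnected) ∧
    (∀ v ∈ H.vertexSet, ∀ w ∈ H.vertexSet, v ≠ w →
      Disjoint (branch v).vertexSet (branch w).vertexSet) ∧
    Function.Injective edge ∧
    (∀ e, ∀ v ∈ H.vertexSet, edge e ∉ (branch v).edgeSet) ∧
    (∀ (e : H.edgeSet) (v w : γ), H.IsLink e v w →
      ∃ x ∈ (branch v).vertexSet, ∃ y ∈ (branch w).vertexSet, G.IsLink (edge e) x y)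

/-- The graph `θ_r`: two vertices joined by `r` parallel edges. -/
def theta (r : ℕ) : Graph Bool (Fin r) :=
  Graph.banana false true Set.univ

/-- The graph `k · J`: the disjoint union of `k` copies of `J`. -/
def copies {γ δ : Type*} (k : ℕ) (J : Graph γ δ) : Graph (Fin k × γ) (Fin k × δ) where
  vertexSet := {p | p.2 ∈ J.vertexSet}
  IsLink e x y := x.1 = e.1 ∧ y.1 = e.1 ∧ J.IsLink e.2 x.2 y.2
  isLink_symm := fun _ _ => ⟨fun _ _ h => ⟨h.2.1, h.1, h.2.2.symm⟩⟩
  eq_or_eq_of_isLink_of_isLink := by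
    rintro ⟨i, e⟩ ⟨i₁, x⟩ ⟨i₂, y⟩ ⟨i₃, v⟩ ⟨i₄, w⟩ ⟨h₁, h₂, h⟩ ⟨h₃, h₄, h'⟩
    dsimp only at h₁ h₂ h h₃ h₄ h'
    subst h₁ h₂ h₃ h₄
    rcases h.left_eq_or_eq h' with rfl | rfl
    · exact Or.inl rfl
    · exact Or.inr rfl
  left_mem_of_isLink := fun _ _ _ h => h.2.2.left_mem

/-- A tree-decomposition of `G` whose tree has the (finite) node set `ι`. -/
structure TreeDecomposition {α β : Type*} (G : Graph α β) (ι : Type) where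
  /-- The tree. -/
  tree : SimpleGraph ι
  /-- The bag of each node of the tree. -/
  bag : ι → Set α
  isTree : tree.IsTree
  exists_bag_of_isLink : ∀ e x y, G.IsLink e x y → ∃ t, x ∈ bag t ∧ y ∈ bag t
  connected : ∀ u ∈ G.vertexSet, (tree.induce {t | u ∈ bag t}).Connected
  iUnion_bag : ⋃ t, bag t = G.vertexSet

/-- The width of a tree-decomposition: the maximum size of a bag, minus one. -/
noncomputable def TreeDecomposition.width {α β : Type*} {G : Graph α β} {ι : Type} [Fintype ι]
    (D : TreeDecomposition G ι) : ℤ :=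
  ((Finset.univ.sup fun t => (D.bag t).ncard : ℕ) : ℤ) - 1

/-- The treewidth of a finite multigraph: the minimum width of a tree-decomposition of it
(so the graph without vertices has treewidth `-1`). -/
noncomputable def treewidth {α β : Type*} (G : Graph α β) : ℤ :=
  sInf {w : ℤ | ∃ (ι : Type) (_ : Fintype ι) (D : TreeDecomposition G ι), D.width = w}

end Graph

/-! The source of `k log k` is a dichotomy: either there is a model of `θ_r` on `O_r(log k)`
vertices, which is cheap to delete, or the graph contracts to one so dense that all `k` models
appear at once.

If the treewidth is at least `3 * m`, some vertex set `W` has no balanced separator with fewer than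
`m` vertices; otherwise the usual recursive construction gives bags of size at most `3 * m - 1`
(`exists_bagSequence`). This is kept in the more flexible form `Tangled`, where vertices cost `t`
and edges cost `1`. Deleting `M` lowers the order by `t * M.card` (`Tangled.del`). Contracting an
edge that has at most `t` edges leaving it lowers nothing (`Tangled.contract`), because removing the
merged vertex can be replaced by cutting those edges. Contracting a vertex into its only neighbour
is equally harmless.

`Tangled.packing` therefore deletes small models, at most `k` times, and contracts such edges
whenever it can. If neither is possible, low-degree vertices are pairwise nonadjacent. Absorbing
each into a neighbour gives a quotient of minimum degree at least `(r + 1) * (r - 1)`, still without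
small models (`packing_of_irreducible`).

There, two disjoint sets of small radius are joined by fewer than `r` edges, since `r` edges with
paths to the centres would be a small model. The same argument bounds the edges inside a shallow
set, so at least `r - 1` edges per vertex leave it. Balls hence double with each unit of radius.
Partition the graph into cells of radius at most `2 * ρ`, each containing a ball of radius `ρ`:
every cell has at least `2 ^ ρ` neighbouring cells (`packing_of_deg`). With `2 ^ ρ` about `k * r`,
contracting the cells gives a multigraph to which `packing_of_dense` applies. -/

/-- A loopless multigraph with vertex set `V`, given by its edge multiplicities. -/
structure Multigraph (V : Type*) where
  /-- The number of edges between two vertices. -/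
  mult : V → V → ℕ
  symm : ∀ x y, mult x y = mult y x
  diag : ∀ x, mult x x = 0

/-! ### Multigraphs given by multiplicities: connected sets and packings -/

namespace Multigraph

section

set_option linter.unusedSectionVars false

open scoped Classical

variable {V : Type*} [Fintype V] [DecidableEq V] (G : Multigraph V)

/-- The number of edges between two disjoint vertex sets. -/
def edges (P Q : Finset V) : ℕ := ∑ x ∈ P, ∑ y ∈ Q, G.mult x y

/-- A nonempty vertex set that induces a connected subgraph. -/
def Conn (P : Finset V) : Prop :=
  P.Nonempty ∧ ∀ x ∈ P, ∀ y ∈ P,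
    Relation.ReflTransGen (fun a b => a ∈ P ∧ b ∈ P ∧ 0 < G.mult a b) x y

/-- The number of edges at a vertex. -/
def deg (x : V) : ℕ := ∑ y, G.mult x y

/-- The set of vertices that are not isolated. -/
noncomputable def active : Finset V := Finset.univ.filter fun x => ∃ y, 0 < G.mult x y

/-- The multigraph obtained by identifying vertices along `h` and removing loops. -/
noncomputable def quot (h : V → V) : Multigraph V where
  mult a b := if a = b then 0 else
    ∑ x ∈ Finset.univ.filter (h · = a), ∑ y ∈ Finset.univ.filter (h · = b), G.mult x y
  symm a b := by
    by_cases hab : a = b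
    · simp [hab]
    · rw [if_neg hab, if_neg (Ne.symm hab), Finset.sum_comm]
      simp_rw [G.symm]
  diag a := by simp

/-- The multigraph obtained by removing all edges that meet `M`. -/
noncomputable def del (M : Finset V) : Multigraph V where
  mult x y := if x ∈ M ∨ y ∈ M then 0 else G.mult x y
  symm x y := by simp only [G.symm x y, or_comm]
  diag x := by simp [G.diag]

/-- A family of `K` disjoint models of the graph with two vertices and `r` parallel edges. -/
def Packing (K r : ℕ) : Prop :=
  ∃ B : Fin K × Bool → Finset V, (∀ i, G.Conn (B i)) ∧
    (∀ i j, i ≠ j → Disjoint (B i) (B j)) ∧ ∀ i, r ≤ G.edges (B (i, false)) (B (i, true))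

/-- No model of the graph with two vertices and `r` parallel edges has at most `s` vertices. -/
def NoSmallModel (r s : ℕ) : Prop :=
  ∀ P Q : Finset V, G.Conn P → G.Conn Q → Disjoint P Q → P.card + Q.card ≤ s → G.edges P Q < r

variable {G}

theorem mem_active {x : V} : x ∈ G.active ↔ ∃ y, 0 < G.mult x y := by simp [active]

theorem ne_of_mult_pos {x y : V} (h : 0 < G.mult x y) : x ≠ y := by
  rintro rfl; simp [G.diag] at h

theorem mem_active_left {x y : V} (h : 0 < G.mult x y) : x ∈ G.active := mem_active.2 ⟨y, h⟩

theorem mem_active_right {x y : V} (h : 0 < G.mult x y) : y ∈ G.active :=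
  mem_active.2 ⟨x, G.symm x y ▸ h⟩

theorem mem_active_iff_deg_pos {x : V} : x ∈ G.active ↔ 0 < G.deg x := by
  rw [mem_active, deg, Finset.sum_pos_iff]
  simp

theorem edges_comm (P Q : Finset V) : G.edges P Q = G.edges Q P := by
  rw [edges, Finset.sum_comm]; simp_rw [G.symm]; rfl

theorem edges_mono {P P' Q Q' : Finset V} (hP : P ⊆ P') (hQ : Q ⊆ Q') :
    G.edges P Q ≤ G.edges P' Q' :=
  (Finset.sum_le_sum fun _ _ => Finset.sum_le_sum_of_subset hQ).trans
    (Finset.sum_le_sum_of_subset hP)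

theorem edges_pos_iff {P Q : Finset V} :
    0 < G.edges P Q ↔ ∃ x ∈ P, ∃ y ∈ Q, 0 < G.mult x y := by
  simp only [edges, Finset.sum_pos_iff]

theorem edges_singleton (x y : V) : G.edges {x} {y} = G.mult x y := by simp [edges]

theorem conn_singleton (x : V) : G.Conn {x} := by
  refine ⟨⟨x, by simp⟩, ?_⟩
  simp only [Finset.mem_singleton]
  rintro a rfl b rfl
  exact .refl

theorem conn_of_root {P : Finset V} {c : V} (hc : c ∈ P)
    (h : ∀ x ∈ P, Relation.ReflTransGen (fun a b => a ∈ P ∧ b ∈ P ∧ 0 < G.mult a b) c x) :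
    G.Conn P := by
  refine ⟨⟨c, hc⟩, fun x hx y hy => .trans ?_ (h y hy)⟩
  have hs : Std.Symm fun a b => a ∈ P ∧ b ∈ P ∧ 0 < G.mult a b :=
    ⟨fun a b ⟨h1, h2, h3⟩ => ⟨h2, h1, G.symm a b ▸ h3⟩⟩
  exact Relation.ReflTransGen.stdSymm.symm _ _ (h x hx)

theorem reflTransGen_mono {P Q : Finset V} (h : P ⊆ Q) {x y : V}
    (hxy : Relation.ReflTransGen (fun a b => a ∈ P ∧ b ∈ P ∧ 0 < G.mult a b) x y) :
    Relation.ReflTransGen (fun a b => a ∈ Q ∧ b ∈ Q ∧ 0 < G.mult a b) x y :=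
  Relation.ReflTransGen.mono (fun _ _ ⟨h1, h2, h3⟩ => ⟨h h1, h h2, h3⟩) _ _ hxy

theorem Conn.union {P Q : Finset V} (hP : G.Conn P) (hQ : G.Conn Q) {c : V} (h1 : c ∈ P)
    (h2 : c ∈ Q) : G.Conn (P ∪ Q) := by
  refine conn_of_root (Finset.mem_union_left _ h1) fun x hx => ?_
  rcases Finset.mem_union.1 hx with hx | hx
  · exact reflTransGen_mono Finset.subset_union_left (hP.2 c h1 x hx)
  · exact reflTransGen_mono Finset.subset_union_right (hQ.2 c h2 x hx)

theorem Conn.insert {P : Finset V} (hP : G.Conn P) {x y : V} (hx : x ∈ P)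
    (hxy : 0 < G.mult x y) : G.Conn (insert y P) := by
  refine conn_of_root (Finset.mem_insert_of_mem hx) fun z hz => ?_
  rcases Finset.mem_insert.1 hz with rfl | hz
  · exact .single ⟨Finset.mem_insert_of_mem hx, Finset.mem_insert_self _ _, hxy⟩
  · exact reflTransGen_mono (Finset.subset_insert _ _) (hP.2 x hx z hz)

theorem conn_pair {x y : V} (h : 0 < G.mult x y) : G.Conn {x, y} := by
  have := (G.conn_singleton y).insert (Finset.mem_singleton_self y) (G.symm x y ▸ h)
  exact this

/-- In a connected set some edge leaves any nonempty proper part. -/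
theorem Conn.exists_edge {P A : Finset V} (hP : G.Conn P) (hAP : A ⊆ P) (hA : A.Nonempty)
    (hne : A ≠ P) : ∃ x ∈ A, ∃ y ∈ P, y ∉ A ∧ 0 < G.mult x y := by
  by_contra! hcon
  obtain ⟨a, ha⟩ := hA
  refine hne (hAP.antisymm fun b hb => ?_)
  induction hP.2 a (hAP ha) b hb with
  | refl => exact ha
  | @tail c d _ hcd ih =>
    by_contra hd
    have := hcon c (ih hcd.1) d hcd.2.1 hd
    omega

theorem Conn.mem_active {P : Finset V} (hP : G.Conn P) {x : V} (hx : x ∈ P)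
    (hxa : x ∈ G.active) {y : V} (hy : y ∈ P) : y ∈ G.active := by
  rcases (hP.2 x hx y hy).cases_tail with rfl | ⟨z, _, hz⟩
  · exact hxa
  · exact mem_active_right hz.2.2

theorem Conn.mem_active_of_edges_pos {P Q : Finset V} (hP : G.Conn P) (h : 0 < G.edges P Q)
    {y : V} (hy : y ∈ P) : y ∈ G.active := by
  obtain ⟨x, hx, z, -, hxz⟩ := edges_pos_iff.1 h
  exact hP.mem_active hx (mem_active_left hxz) hy

theorem Packing.mono {K r : ℕ} (h : G.Packing K r) {K' r' : ℕ} (hK : K' ≤ K) (hr : r' ≤ r) :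
    G.Packing K' r' := by
  obtain ⟨B, h1, h2, h3⟩ := h
  refine ⟨fun i => B (Fin.castLE hK i.1, i.2), fun i => h1 _, fun i j hij => h2 _ _ ?_,
    fun i => hr.trans (h3 _)⟩
  intro h
  rw [Prod.mk.injEq] at h
  exact hij (Prod.ext (Fin.castLE_injective hK h.1) h.2)

theorem packing_zero (r : ℕ) : G.Packing 0 r :=
  ⟨fun _ => ∅, fun i => i.1.elim0, fun i => i.1.elim0, fun i => i.elim0⟩

/-! ### Identifying vertices -/

section Quot

variable {h : V → V}

theorem quot_mult_of_ne {a b : V} (hab : a ≠ b) : (G.quot h).mult a b =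
    ∑ x ∈ Finset.univ.filter (h · = a), ∑ y ∈ Finset.univ.filter (h · = b), G.mult x y :=
  if_neg hab

theorem quot_mult_pos {a b : V} : 0 < (G.quot h).mult a b ↔
    a ≠ b ∧ ∃ x y, h x = a ∧ h y = b ∧ 0 < G.mult x y := by
  by_cases hab : a = b
  · simp [hab, Multigraph.diag]
  · simp only [quot_mult_of_ne hab, Finset.sum_pos_iff, Finset.mem_filter, Finset.mem_univ,
      true_and, ne_eq, hab, not_false_eq_true]
    constructor
    · rintro ⟨x, hx, y, hy, h⟩; exact ⟨x, y, hx, hy, h⟩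
    · rintro ⟨x, y, hx, hy, h⟩; exact ⟨x, hx, y, hy, h⟩

/-- Sums over the edges of a quotient are sums over the edges of the multigraph. -/
theorem sum_quot (F : V → V → ℕ) (hF : ∀ a, F a a = 0) :
    ∑ a, ∑ b, F a b * (G.quot h).mult a b = ∑ x, ∑ y, F (h x) (h y) * G.mult x y := by
  have e1 : ∀ a b, F a b * (G.quot h).mult a b =
      ∑ x ∈ Finset.univ.filter (h · = a), ∑ y ∈ Finset.univ.filter (h · = b),
        F (h x) (h y) * G.mult x y := by
    intro a b
    -- The quotient drops loops, which is harmless because `F` vanishes on the diagonal.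
    by_cases hab : a = b
    · subst hab
      rw [hF, zero_mul]
      symm
      refine Finset.sum_eq_zero fun x hx => Finset.sum_eq_zero fun y hy => ?_
      rw [(Finset.mem_filter.1 hx).2, (Finset.mem_filter.1 hy).2, hF, zero_mul]
    · rw [quot_mult_of_ne hab, Finset.mul_sum]
      refine Finset.sum_congr rfl fun x hx => ?_
      rw [Finset.mul_sum]
      refine Finset.sum_congr rfl fun y hy => ?_
      rw [(Finset.mem_filter.1 hx).2, (Finset.mem_filter.1 hy).2]
  simp_rw [e1]
  have e2 : ∀ a, ∑ b, ∑ x ∈ Finset.univ.filter (h · = a),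
      ∑ y ∈ Finset.univ.filter (h · = b), F (h x) (h y) * G.mult x y =
      ∑ x ∈ Finset.univ.filter (h · = a), ∑ y, F (h x) (h y) * G.mult x y := by
    intro a
    rw [Finset.sum_comm]
    exact Finset.sum_congr rfl fun x _ => Finset.sum_fiberwise _ _ _
  simp_rw [e2]
  exact Finset.sum_fiberwise _ _ _

theorem edges_eq_sum (P Q : Finset V) :
    G.edges P Q = ∑ x, ∑ y, (if x ∈ P ∧ y ∈ Q then 1 else 0) * G.mult x y := by
  rw [edges, ← Finset.sum_filter_add_sum_filter_not Finset.univ (· ∈ P), Finset.filter_univ_mem]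
  rw [Finset.sum_eq_zero (s := Finset.univ.filter (· ∉ P)), add_zero]
  · refine Finset.sum_congr rfl fun x hx => ?_
    simp [hx, Finset.sum_ite_mem]
  · intro x hx
    simp [(Finset.mem_filter.1 hx).2]

/-- The preimage of a vertex set under a map. -/
noncomputable def pre (h : V → V) (P : Finset V) : Finset V := Finset.univ.filter (h · ∈ P)

theorem mem_pre {P : Finset V} {x : V} : x ∈ pre h P ↔ h x ∈ P := by simp [pre]

theorem disjoint_pre {P Q : Finset V} (hPQ : Disjoint P Q) : Disjoint (pre h P) (pre h Q) := by
  rw [Finset.disjoint_left] at *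
  exact fun x hx hx' => hPQ (mem_pre.1 hx) (mem_pre.1 hx')

theorem edges_quot {P Q : Finset V} (hPQ : Disjoint P Q) :
    (G.quot h).edges P Q = G.edges (pre h P) (pre h Q) := by
  rw [edges_eq_sum, edges_eq_sum, sum_quot]
  · simp [mem_pre]
  · intro a
    rw [if_neg]
    exact fun h => Finset.disjoint_left.1 hPQ h.1 h.2

/-- Lift a path in the quotient edge by edge, moving inside fibres between consecutive edges. The
quotient keeps the vertex type `V`, so elements outside the range of `h` persist as isolated
vertices; this is why `hne` is needed and why only nonempty fibres must be connected. -/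
theorem conn_pre {P : Finset V} (hP : (G.quot h).Conn P)
    (hfib : ∀ a, (pre h {a}).Nonempty → G.Conn (pre h {a})) (hne : (pre h P).Nonempty) :
    G.Conn (pre h P) := by
  obtain ⟨c, hc⟩ := hne
  refine conn_of_root hc fun y hy => ?_
  have key : ∀ b, Relation.ReflTransGen (fun a b => a ∈ P ∧ b ∈ P ∧ 0 < (G.quot h).mult a b)
      (h c) b → b ∈ P → ∀ y, h y = b →
      Relation.ReflTransGen (fun a b => a ∈ pre h P ∧ b ∈ pre h P ∧ 0 < G.mult a b) c y := by
    intro b hb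
    induction hb with
    | refl =>
      intro hP y hy
      exact reflTransGen_mono (fun x hx => mem_pre.2 (by
          rw [Finset.mem_singleton.1 (mem_pre.1 hx)]; exact hP))
        ((hfib (h c) ⟨c, by simp [mem_pre]⟩).2 c (by simp [mem_pre]) y (by simp [mem_pre, hy]))
    | @tail a b _ hab ih =>
      intro hb y hy
      obtain ⟨-, x, z, hx, hz, hxz⟩ := quot_mult_pos.1 hab.2.2
      refine (ih hab.1 x hx).trans (.head ⟨mem_pre.2 (hx ▸ hab.1), mem_pre.2 (hz ▸ hb), hxz⟩ ?_)
      exact reflTransGen_mono (fun x hx => mem_pre.2 (by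
          rw [Finset.mem_singleton.1 (mem_pre.1 hx)]; exact hb))
        ((hfib b ⟨y, by simp [mem_pre, hy]⟩).2 z (by simp [mem_pre, hz]) y (by simp [mem_pre, hy]))
  exact key (h y) (hP.2 _ (mem_pre.1 hc) _ (mem_pre.1 hy)) (mem_pre.1 hy) y rfl

theorem Packing.of_quot {K r : ℕ} (hr : 0 < r) (hp : (G.quot h).Packing K r)
    (hfib : ∀ a, (pre h {a}).Nonempty → G.Conn (pre h {a})) : G.Packing K r := by
  obtain ⟨B, h1, h2, h3⟩ := hp
  have h4 : ∀ i, r ≤ G.edges (pre h (B (i, false))) (pre h (B (i, true))) := fun i => by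
    rw [← edges_quot (h2 _ _ (by simp))]; exact h3 i
  refine ⟨fun i => pre h (B i), fun i => conn_pre (h1 i) hfib ?_,
    fun i j hij => disjoint_pre (h2 i j hij), h4⟩
  obtain ⟨x, hx, y, hy, -⟩ := edges_pos_iff.1 (hr.trans_le (h4 i.1))
  rcases i with ⟨i, _ | _⟩
  exacts [⟨x, hx⟩, ⟨y, hy⟩]

end Quot

/-! ### Deleting vertices -/

section Del

variable {M : Finset V}

theorem del_mult_le (x y : V) : (G.del M).mult x y ≤ G.mult x y := by
  simp only [del]; split_ifs <;> simp

theorem del_mult_of_notMem {x y : V} (hx : x ∉ M) (hy : y ∉ M) :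
    (G.del M).mult x y = G.mult x y := by simp [del, hx, hy]

theorem notMem_of_mem_active_del {x : V} (hx : x ∈ (G.del M).active) : x ∉ M := by
  obtain ⟨y, hy⟩ := Multigraph.mem_active.1 hx
  intro hM
  simp [del, hM] at hy

theorem active_del_subset : (G.del M).active ⊆ G.active := fun x hx => by
  obtain ⟨y, hy⟩ := Multigraph.mem_active.1 hx
  exact mem_active_left (hy.trans_le (del_mult_le x y))

theorem Conn.of_del {P : Finset V} (h : (G.del M).Conn P) : G.Conn P :=
  ⟨h.1, fun x hx y hy => Relation.ReflTransGen.mono (fun _ _ ⟨h1, h2, h3⟩ =>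
    ⟨h1, h2, h3.trans_le (del_mult_le _ _)⟩) _ _ (h.2 x hx y hy)⟩

/-- Deleted vertices remain as isolated ones. Since `0 < r`, each branch set of the packing is
connected and carries an edge, so it consists of active vertices and automatically avoids `P ∪ Q`.
-/
theorem Packing.of_del {K r : ℕ} (hr : 0 < r) {P Q : Finset V} (hP : G.Conn P) (hQ : G.Conn Q)
    (hPQ : Disjoint P Q) (he : r ≤ G.edges P Q) (hp : (G.del (P ∪ Q)).Packing K r) :
    G.Packing (K + 1) r := by
  obtain ⟨B, h1, h2, h3⟩ := hp
  have hB : ∀ i, Disjoint (B i) (P ∪ Q) := by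
    intro i
    rw [Finset.disjoint_left]
    intro x hx
    apply notMem_of_mem_active_del (G := G)
    rcases i with ⟨i, _ | _⟩
    · exact (h1 _).mem_active_of_edges_pos (hr.trans_le (h3 i)) hx
    · exact (h1 _).mem_active_of_edges_pos (hr.trans_le ((h3 i).trans_eq (edges_comm _ _))) hx
  refine ⟨fun i => Fin.cases (if i.2 then Q else P) (fun j => B (j, i.2)) i.1, ?_, ?_, ?_⟩
  · rintro ⟨i, b⟩
    cases i using Fin.cases with
    | zero => cases b <;> simp [hP, hQ]
    | succ i => simpa using (h1 _).of_del
  · rintro ⟨i, b⟩ ⟨j, b'⟩ hij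
    cases i using Fin.cases with
    | zero =>
      cases j using Fin.cases with
      | zero => cases b <;> cases b' <;> simp_all [hPQ.symm]
      | succ j =>
        have := (hB (j, b')).symm
        rw [Finset.disjoint_union_left] at this
        cases b <;> simp [this]
    | succ i =>
      cases j using Fin.cases with
      | zero =>
        have := (hB (i, b))
        rw [Finset.disjoint_union_right] at this
        cases b' <;> simp [this]
      | succ j =>
        refine h2 _ _ ?_
        simpa using hij
  · intro i
    cases i using Fin.cases with
    | zero => simpa using he
    | succ i =>
      refine (h3 i).trans ?_
      exact Finset.sum_le_sum fun x _ => Finset.sum_le_sum fun y _ => del_mult_le x y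

end Del

/-! ### Tangled multigraphs and their behaviour under deletion and contraction -/

variable (G)

/-- Twice the number of edges between vertices outside `S` of different colours. -/
noncomputable def cut (S : Finset V) (c : V → ℕ) : ℕ :=
  ∑ x, ∑ y, (if x ∉ S ∧ y ∉ S ∧ c x ≠ c y then 1 else 0) * G.mult x y

/-- The total weight of the vertices outside `S` of colour `a`. -/
noncomputable def classWeight (p : V → ℕ) (S : Finset V) (c : V → ℕ) (a : ℕ) : ℕ :=
  ∑ x, (if x ∉ S ∧ c x = a then 1 else 0) * p x

/-- If vertices have removal cost `t` and edges have removal cost `1`, then after any removal of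
cost less than `m` the vertices cannot be split into parts, each of weight at most `n / 2`, that
are pairwise joined by no edge. -/
def Tangled (p : V → ℕ) (n t m : ℕ) : Prop :=
  ∑ x, p x ≤ n ∧ ∀ (S : Finset V) (c : V → ℕ), 2 * (t * S.card) + G.cut S c < 2 * m →
    ∃ a, n < 2 * classWeight p S c a

/-- The push-forward of a vertex weight. -/
noncomputable def pushWeight (h : V → V) (p : V → ℕ) (a : V) : ℕ :=
  ∑ x ∈ Finset.univ.filter (h · = a), p x

variable {G}

theorem sum_pushWeight (h : V → V) (p g : V → ℕ) :
    ∑ a, g a * pushWeight h p a = ∑ x, g (h x) * p x := by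
  rw [← Finset.sum_fiberwise Finset.univ h (fun x => g (h x) * p x)]
  refine Finset.sum_congr rfl fun a _ => ?_
  rw [pushWeight, Finset.mul_sum]
  refine Finset.sum_congr rfl fun x hx => ?_
  rw [(Finset.mem_filter.1 hx).2]

theorem classWeight_le_sum (p : V → ℕ) (S : Finset V) (c : V → ℕ) (a : ℕ) (Z : Finset V)
    (hZ : ∀ x, x ∉ S → c x = a → x ∈ Z) : classWeight p S c a ≤ ∑ x ∈ Z, p x := by
  rw [classWeight, ← Finset.sum_subset (Finset.subset_univ Z)]
  · refine Finset.sum_le_sum fun x _ => ?_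
    split_ifs <;> simp
  · intro x _ hx
    rw [if_neg (fun h => hx (hZ x h.1 h.2)), zero_mul]

variable {p : V → ℕ} {n t m : ℕ}

/-- Removing `Z` and giving all other vertices one colour leaves that colour with more than half of
the weight. -/
theorem Tangled.light (hT : G.Tangled p n t m) {Z : Finset V} (hZ : t * Z.card < m) :
    2 * ∑ x ∈ Z, p x ≤ n := by
  obtain ⟨a, ha⟩ := hT.2 Z (fun _ => 0) (by simp [cut]; omega)
  have h1 := classWeight_le_sum p Z (fun _ => 0) a Zᶜ (fun x hx _ => Finset.mem_compl.2 hx)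
  have h2 := Finset.sum_add_sum_compl Z p
  have h3 := hT.1
  omega

theorem Tangled.del (hT : G.Tangled p n t m) {M : Finset V} {m' : ℕ}
    (hm : m' + t * M.card ≤ m) : ∃ p', (G.del M).Tangled p' n t m' := by
  refine ⟨p, hT.1, fun S c hc => ?_⟩
  obtain ⟨a, ha⟩ := hT.2 (S ∪ M) c (by
    have h1 : G.cut (S ∪ M) c ≤ (G.del M).cut S c := by
      refine Finset.sum_le_sum fun x _ => Finset.sum_le_sum fun y _ => ?_
      by_cases h : x ∉ S ∪ M ∧ y ∉ S ∪ M ∧ c x ≠ c y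
      · obtain ⟨hx, hy, h⟩ := h
        rw [Finset.notMem_union] at hx hy
        rw [del_mult_of_notMem hx.2 hy.2]
        simp [hx, hy, h]
      · rw [if_neg h]; simp
    have h2 : t * (S ∪ M).card ≤ t * S.card + t * M.card := by
      rw [← mul_add]; exact Nat.mul_le_mul_left _ (Finset.card_union_le _ _)
    omega)
  refine ⟨a, ha.trans_le (Nat.mul_le_mul_left _ (Finset.sum_le_sum fun x _ => ?_))⟩
  gcongr
  by_cases hx : x ∈ S <;> simp [hx]
  split_ifs <;> simp_all

/-- Without edges, an injective colouring cuts nothing, and each of its classes is a single vertex,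
which is light. -/
theorem Tangled.exists_adj (hT : G.Tangled p n t m) (hm : t < m) : G.active.Nonempty := by
  by_contra hcon
  have h0 : ∀ x y, G.mult x y = 0 := by
    intro x y
    by_contra h
    exact hcon ⟨x, mem_active_left (Nat.pos_of_ne_zero h)⟩
  obtain ⟨e⟩ := (Fintype.truncEquivFin V).nonempty
  obtain ⟨a, ha⟩ := hT.2 ∅ (fun x => e x) (by simp [cut, h0]; omega)
  by_cases hx : ∃ x, (e x : ℕ) = a
  · obtain ⟨x, hx⟩ := hx
    have h1 := classWeight_le_sum p ∅ (fun x => e x) a {x} (fun y _ hy => by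
      rw [Finset.mem_singleton]; exact e.injective (Fin.ext (hy.trans hx.symm)))
    have h2 := hT.light (Z := {x}) (by simpa using hm)
    omega
  · have h1 := classWeight_le_sum p ∅ (fun x => e x) a ∅ (fun y _ hy => (hx ⟨y, hy⟩).elim)
    simp at h1
    omega

section Contract

variable {u v : V}

theorem quot_update_mult {x y : V} (hx : x ≠ u) (hx' : x ≠ v) (hy : y ≠ u) (hy' : y ≠ v) :
    (G.quot (Function.update id v u)).mult x y = G.mult x y := by
  by_cases hxy : x = y
  · rw [hxy, Multigraph.diag, Multigraph.diag]
  have key : ∀ z, z ≠ u → z ≠ v →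
      Finset.univ.filter (Function.update id v u · = z) = {z} := by
    intro z hz hz'
    ext a
    simp only [Finset.mem_filter, Finset.mem_univ, true_and, Finset.mem_singleton]
    by_cases ha : a = v
    · subst ha; simp [Ne.symm hz, Ne.symm hz']
    · simp [Function.update_of_ne ha]
  rw [quot_mult_of_ne hxy, key x hx hx', key y hy hy']
  simp

/-- A removal in the quotient is turned into one in `G` of no greater cost. The hypothesis `hcost`
says that when the merged vertex `u` is removed, isolating `Z` by cutting its edges is no dearer;
`hZ` says that the isolated `Z` cannot be the heavy part. -/
theorem Tangled.contract (hT : G.Tangled p n t m) {Z : Finset V} (hv : v ∈ Z)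
    (hZ : 2 * ∑ x ∈ Z, p x ≤ n)
    (hcost : ∀ S : Finset V, u ∈ S → t * (S \ Z).card + G.edges Z (S ∪ Z)ᶜ ≤ t * S.card) :
    (G.quot (Function.update id v u)).Tangled (pushWeight (Function.update id v u) p) n t m := by
  set h := Function.update id v u with hh
  have hhv : h v = u := by simp [hh]
  have hhx : ∀ x, x ≠ v → h x = x := fun x hx => by simp [hh, Function.update_of_ne hx]
  refine ⟨?_, fun S c hc => ?_⟩
  · have := sum_pushWeight h p fun _ => 1
    simp only [one_mul] at this
    exact this.trans_le hT.1
  by_cases hu : u ∈ S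
  -- Keep `Z` in the graph under the private colour `0` and shift all other colours by one.
  · obtain ⟨a, ha⟩ := hT.2 (S \ Z) (fun x => if x ∈ Z then 0 else c x + 1) (by
      have h1 : G.cut (S \ Z) (fun x => if x ∈ Z then 0 else c x + 1) ≤
          (G.quot h).cut S c + G.edges Z (S ∪ Z)ᶜ + G.edges (S ∪ Z)ᶜ Z := by
        rw [edges_eq_sum, edges_eq_sum]
        simp only [cut, ← Finset.sum_add_distrib]
        refine Finset.sum_le_sum fun x _ => Finset.sum_le_sum fun y _ => ?_
        by_cases hx : x ∈ Z
        · by_cases hy : y ∈ Z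
          · simp [hx, hy]
          · by_cases hyS : y ∈ S <;> simp [hx, hy, hyS]
        · by_cases hy : y ∈ Z
          · by_cases hxS : x ∈ S <;> simp [hx, hy, hxS]
          · by_cases hxS : x ∈ S
            · simp [hx, hxS]
            · by_cases hyS : y ∈ S
              · simp [hy, hyS]
              · have := quot_update_mult (G := G) (u := u) (v := v) (x := x) (y := y)
                  (fun h => hxS (h ▸ hu)) (fun h => hx (h ▸ hv))
                  (fun h => hyS (h ▸ hu)) (fun h => hy (h ▸ hv))
                rw [hh, this]
                simp [hx, hy, hxS, hyS]
      rw [edges_comm _ Z] at h1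
      have h2 := hcost S hu
      omega)
    rcases a with _ | a
    · have h1 := classWeight_le_sum p (S \ Z) (fun x => if x ∈ Z then 0 else c x + 1) 0 Z
        (fun x _ hx => by by_contra h; simp [h] at hx)
      omega
    · refine ⟨a, ha.trans_le (Nat.mul_le_mul_left _ (Finset.sum_le_sum fun x _ => ?_))⟩
      by_cases hx : x ∈ Z
      · simp [hx]
      · have hxv : x ≠ v := fun h => hx (h ▸ hv)
        simp only [Finset.mem_sdiff, hx, not_false_eq_true, and_true, if_false,
          Nat.add_right_cancel_iff]
        gcongr
        exact Finset.single_le_sum (f := p) (fun _ _ => Nat.zero_le _)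
          (Finset.mem_filter.2 ⟨Finset.mem_univ _, hhx x hxv⟩)
  -- The merged vertex survives, so the removal pulls back along `h`; `v` is not in the preimage of
  -- `S`, whose size therefore does not grow.
  · obtain ⟨a, ha⟩ := hT.2 (pre h S) (fun x => c (h x)) (by
      have h1 : (pre h S).card ≤ S.card := by
        refine Finset.card_le_card fun x hx => ?_
        rw [mem_pre] at hx
        by_cases hxv : x = v
        · rw [hxv, hhv] at hx; exact (hu hx).elim
        · rwa [hhx x hxv] at hx
      have h2 : (G.quot h).cut S c = G.cut (pre h S) (fun x => c (h x)) := by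
        rw [cut, cut, sum_quot]
        · simp only [mem_pre]
        · simp
      have h3 := Nat.mul_le_mul_left t h1
      omega)
    refine ⟨a, ?_⟩
    rw [classWeight, sum_pushWeight h p (fun x => if x ∉ S ∧ c x = a then 1 else 0)]
    simpa only [classWeight, mem_pre] using ha

/-- Sparing `u` from the removal saves `t`, which pays for the at most `t` edges leaving the pair.
-/
theorem Tangled.contract_of_edges_le (hT : G.Tangled p n t m) (huv : u ≠ v) (hm : 2 * t < m)
    (he : G.edges {u, v} {u, v}ᶜ ≤ t) :
    (G.quot (Function.update id v u)).Tangled (pushWeight (Function.update id v u) p) n t m := by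
  refine hT.contract (Z := {u, v}) (by simp) (hT.light ?_) fun S hS => ?_
  · rw [Finset.card_pair huv]; omega
  · have h1 : (S \ {u, v}).card + 1 ≤ S.card :=
      Finset.card_lt_card ((Finset.ssubset_iff_of_subset Finset.sdiff_subset).2
        ⟨u, hS, by simp⟩)
    have h2 : G.edges {u, v} (S ∪ {u, v})ᶜ ≤ G.edges {u, v} {u, v}ᶜ :=
      edges_mono le_rfl (Finset.compl_subset_compl.2 Finset.subset_union_right)
    have h3 := Nat.mul_le_mul_left t h1
    rw [mul_add] at h3
    omega

/-- With `Z = {v}`, once `u` is removed no edge at `v` is left to be cut. -/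
theorem Tangled.contract_of_unique (hT : G.Tangled p n t m) (hm : t < m)
    (he : ∀ x, 0 < G.mult v x → x = u) :
    (G.quot (Function.update id v u)).Tangled (pushWeight (Function.update id v u) p) n t m := by
  refine hT.contract (Z := {v}) (by simp) (hT.light ?_) fun S hS => ?_
  · simpa using hm
  · have h1 : G.edges {v} (S ∪ {v})ᶜ = 0 := by
      by_contra h
      obtain ⟨x, hx, y, hy, hxy⟩ := edges_pos_iff.1 (Nat.pos_of_ne_zero h)
      rw [Finset.mem_singleton] at hx
      subst hx
      rw [he y hxy] at hy
      simp [hS] at hy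
    rw [h1, add_zero]
    exact Nat.mul_le_mul_left t (Finset.card_le_card Finset.sdiff_subset)

theorem active_quot_update_ssubset (huv : 0 < G.mult u v) :
    (G.quot (Function.update id v u)).active ⊂ G.active := by
  have hne := ne_of_mult_pos huv
  refine (Finset.ssubset_iff_of_subset fun x hx => ?_).2 ⟨v, mem_active_right huv, fun hv => ?_⟩
  · obtain ⟨y, hy⟩ := mem_active.1 hx
    obtain ⟨-, a, b, ha, -, hab⟩ := quot_mult_pos.1 hy
    by_cases hav : a = v
    · subst hav
      simp only [Function.update_self] at ha
      exact ha ▸ mem_active_left huv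
    · rw [Function.update_of_ne hav] at ha
      exact ha ▸ mem_active_left hab
  · obtain ⟨y, hy⟩ := mem_active.1 hv
    obtain ⟨-, a, b, ha, -, hab⟩ := quot_mult_pos.1 hy
    by_cases hav : a = v
    · subst hav
      simp only [Function.update_self] at ha
      exact hne ha
    · rw [Function.update_of_ne hav] at ha
      exact hav ha

theorem Packing.of_contract {K r : ℕ} (hr : 0 < r) (huv : 0 < G.mult u v)
    (hp : (G.quot (Function.update id v u)).Packing K r) : G.Packing K r := by
  refine hp.of_quot hr fun a ⟨z, hz⟩ => ?_
  have hne := ne_of_mult_pos huv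
  rw [mem_pre, Finset.mem_singleton] at hz
  by_cases hau : a = u
  · have : pre (Function.update id v u) {a} = {u, v} := by
      ext x
      by_cases hxv : x = v <;> simp [mem_pre, hau, hxv]
    rw [this]
    exact conn_pair huv
  · have : pre (Function.update id v u) {a} = {a} := by
      ext x
      by_cases hxv : x = v
      · subst hxv
        have hax : a ≠ x := by
          rintro rfl
          by_cases hza : z = a
          · rw [hza, Function.update_self] at hz; exact hau hz.symm
          · rw [Function.update_of_ne hza] at hz; exact hza hz
        simp [mem_pre, Ne.symm hau, Ne.symm hax]
      · simp [mem_pre, hxv]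
    rw [this]
    exact conn_singleton a

end Contract

/-! ### Density forces packings -/

variable (G)

/-- The ordered pairs of adjacent vertices. -/
noncomputable def adjPairs : Finset (V × V) :=
  Finset.univ.filter fun q => 0 < G.mult q.1 q.2

/-- The common neighbours of two vertices. -/
noncomputable def common (u v : V) : Finset V :=
  Finset.univ.filter fun y => 0 < G.mult u y ∧ 0 < G.mult v y

variable {G}

theorem mem_adjPairs {q : V × V} : q ∈ G.adjPairs ↔ 0 < G.mult q.1 q.2 := by simp [adjPairs]

/-- The map on pairs is injective away from `(v, y)` and `(y, v)` with `y = u` or `y` a common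
neighbour; those pairs become loops or are merged with pairs at `u`. -/
theorem card_adjPairs_quot {u v : V} (huv : 0 < G.mult u v) :
    G.adjPairs.card ≤
      (G.quot (Function.update id v u)).adjPairs.card + 2 * ((G.common u v).card + 1) := by
  set h := Function.update id v u with hh
  have hhv : h v = u := by simp [hh]
  have hhx : ∀ x, x ≠ v → h x = x := fun x hx => by simp [hh, Function.update_of_ne hx]
  have hne := ne_of_mult_pos huv
  set T := insert u (G.common u v) with hT
  set E := T.image (fun y => (v, y)) ∪ T.image (fun y => (y, v)) with hE
  have hEc : E.card ≤ 2 * ((G.common u v).card + 1) := by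
    have h1 : E.card ≤ _ :=
      Finset.card_union_le (T.image (fun y => (v, y))) (T.image (fun y => (y, v)))
    have h2 := Finset.card_image_le (s := T) (f := fun y => (v, y))
    have h3 := Finset.card_image_le (s := T) (f := fun y => (y, v))
    have h4 : T.card ≤ _ := Finset.card_insert_le u (G.common u v)
    omega
  have hmemE : ∀ y, 0 < G.mult v y → (0 < G.mult u y ∨ y = u) → (v, y) ∈ E ∧ (y, v) ∈ E := by
    intro y hy hy'
    have : y ∈ T := by
      rw [hT, Finset.mem_insert, common, Finset.mem_filter]
      rcases hy' with hy' | rfl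
      · exact .inr ⟨Finset.mem_univ _, hy', hy⟩
      · exact .inl rfl
    exact ⟨Finset.mem_union_left _ (Finset.mem_image_of_mem _ this),
      Finset.mem_union_right _ (Finset.mem_image_of_mem _ this)⟩
  have hmain : (G.adjPairs \ E).card ≤ (G.quot h).adjPairs.card := by
    refine Finset.card_le_card_of_injOn (fun q => (h q.1, h q.2)) ?_ ?_
    · rintro ⟨x, y⟩ hq
      rw [Finset.mem_coe, Finset.mem_sdiff, mem_adjPairs] at hq
      obtain ⟨hq, hqE⟩ := hq
      have hxy := ne_of_mult_pos hq
      rw [Finset.mem_coe, mem_adjPairs, quot_mult_pos]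
      refine ⟨fun heq => ?_, x, y, rfl, rfl, hq⟩
      dsimp only at heq hq
      by_cases hx : x = v
      · subst hx
        rw [hhv, hhx y hxy.symm] at heq
        exact hqE (hmemE y hq (.inr heq.symm)).1
      · by_cases hy : y = v
        · subst hy
          rw [hhv, hhx x hx] at heq
          exact hqE (hmemE x (G.symm _ _ ▸ hq) (.inr heq)).2
        · rw [hhx x hx, hhx y hy] at heq
          exact hxy heq
    · rintro ⟨x, y⟩ hq ⟨x', y'⟩ hq' heq
      rw [Finset.mem_coe, Finset.mem_sdiff, mem_adjPairs] at hq hq'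
      obtain ⟨hq, hqE⟩ := hq
      obtain ⟨hq', hqE'⟩ := hq'
      have hxy := ne_of_mult_pos hq
      have hxy' := ne_of_mult_pos hq'
      simp only [Prod.mk.injEq] at heq hxy hxy' hq hq' ⊢
      obtain ⟨h1, h2⟩ := heq
      by_cases hx : x = v
      · subst hx
        have hy := hxy.symm
        rw [hhv] at h1
        by_cases hx' : x' = x
        · subst hx'
          rw [hhx y hy, hhx y' hxy'.symm] at h2
          exact ⟨rfl, h2⟩
        · rw [hhx x' hx'] at h1
          subst h1
          by_cases hy' : y' = x
          · subst hy'
            rw [hhv, hhx y hy] at h2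
            exact (hqE (hmemE y hq (.inr h2)).1).elim
          · rw [hhx y hy, hhx y' hy'] at h2
            subst h2
            exact (hqE (hmemE y hq (.inl hq')).1).elim
      · rw [hhx x hx] at h1
        by_cases hx' : x' = v
        · subst hx'
          rw [hhv] at h1
          subst h1
          by_cases hy : y = x'
          · subst hy
            rw [hhv, hhx y' hxy'.symm] at h2
            exact (hqE' (hmemE y' hq' (.inr h2.symm)).1).elim
          · rw [hhx y hy, hhx y' hxy'.symm] at h2
            subst h2
            exact (hqE' (hmemE y hq' (.inl hq)).1).elim
        · rw [hhx x' hx'] at h1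
          subst h1
          refine ⟨rfl, ?_⟩
          by_cases hy : y = v
          · subst hy
            by_cases hy' : y' = y
            · exact hy'.symm
            · rw [hhv, hhx y' hy'] at h2
              subst h2
              exact (hqE (hmemE x (G.symm _ _ ▸ hq) (.inl (G.symm _ _ ▸ hq'))).2).elim
          · by_cases hy' : y' = v
            · subst hy'
              rw [hhv, hhx y hy] at h2
              subst h2
              exact (hqE' (hmemE x (G.symm _ _ ▸ hq') (.inl (G.symm _ _ ▸ hq))).2).elim
            · rwa [hhx y hy, hhx y' hy'] at h2
  have := Finset.le_card_sdiff E G.adjPairs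
  omega

theorem card_adjPairs_del (M : Finset V) :
    G.adjPairs.card ≤ (G.del M).adjPairs.card + 2 * (M.card * G.active.card) := by
  have hsub : G.adjPairs ⊆ (G.del M).adjPairs ∪ (M ×ˢ G.active ∪ G.active ×ˢ M) := by
    rintro ⟨x, y⟩ hq
    rw [mem_adjPairs] at hq
    have hx := mem_active_left hq
    have hy := mem_active_right hq
    simp only [Finset.mem_union, Finset.mem_product, mem_adjPairs]
    by_cases hxM : x ∈ M
    · exact .inr (.inl ⟨hxM, hy⟩)
    · by_cases hyM : y ∈ M
      · exact .inr (.inr ⟨hx, hyM⟩)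
      · left
        rwa [del_mult_of_notMem hxM hyM]
  have h1 := Finset.card_le_card hsub
  have h2 := Finset.card_union_le (G.del M).adjPairs (M ×ˢ G.active ∪ G.active ×ˢ M)
  have h3 := Finset.card_union_le (M ×ˢ G.active) (G.active ×ˢ M)
  rw [Finset.card_product, Finset.card_product, mul_comm G.active.card] at h3
  omega

theorem adjPairs_nonempty_iff : G.adjPairs.Nonempty ↔ G.active.Nonempty := by
  constructor
  · rintro ⟨q, hq⟩
    exact ⟨q.1, mem_active_left (mem_adjPairs.1 hq)⟩
  · rintro ⟨x, hx⟩
    obtain ⟨y, hy⟩ := mem_active.1 hx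
    exact ⟨(x, y), mem_adjPairs.2 hy⟩

/-- A dense multigraph contains many disjoint models. -/
theorem packing_of_dense {r : ℕ} (hr : 0 < r) (K : ℕ) (G : Multigraph V)
    (hne : G.active.Nonempty) (hd : 2 * (K * (r + 2)) * G.active.card ≤ G.adjPairs.card) :
    G.Packing K r := by
  induction K generalizing G with
  | zero => exact packing_zero r
  | succ K ihK =>
    induction hN : G.active.card using Nat.strong_induction_on generalizing G with
    | _ N ih =>
      obtain ⟨u, hu⟩ := hne
      obtain ⟨v, huv⟩ := mem_active.1 hu
      have hNpos : 0 < N := hN ▸ Finset.card_pos.2 ⟨u, hu⟩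
      have hne := ne_of_mult_pos huv
      have hd' : 2 * (K * (r + 2)) * N + 2 * ((r + 2) * N) ≤ G.adjPairs.card := by
        rw [hN] at hd; linarith
      have hrN : r + 2 ≤ (r + 2) * N := Nat.le_mul_of_pos_right _ hNpos
      -- With `r` common neighbours, `u` and these against `v` form a model on at most `r + 2`
      -- vertices, whose deletion loses at most `2 * (r + 2) * N` ordered pairs. Otherwise
      -- contracting `uv` loses at most `2 * r` pairs and one or more active vertices, so the
      -- density bound persists.
      by_cases hc : r ≤ (G.common u v).card
      · obtain ⟨C, hC, hCr⟩ := Finset.exists_subset_card_eq hc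
        have hCmem : ∀ y ∈ C, 0 < G.mult u y ∧ 0 < G.mult v y := fun y hy =>
          (Finset.mem_filter.1 (hC hy)).2
        have hvC : v ∉ C := fun h => by simpa [G.diag] using (hCmem v h).2
        have hP : G.Conn (insert u C) := by
          refine conn_of_root (Finset.mem_insert_self u C) fun x hx => ?_
          rcases Finset.mem_insert.1 hx with rfl | hx'
          · exact .refl
          · exact .single ⟨Finset.mem_insert_self u C, hx, (hCmem x hx').1⟩
        have hdisj : Disjoint (insert u C) {v} := by
          simp [hne.symm, hvC]
        have he : r ≤ G.edges (insert u C) {v} := by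
          refine le_trans ?_ (edges_mono (Finset.subset_insert u C) le_rfl)
          simp only [edges, Finset.sum_singleton]
          rw [← hCr, Finset.card_eq_sum_ones]
          exact Finset.sum_le_sum fun y hy => G.symm v y ▸ (hCmem y hy).2
        have hMc : (insert u C ∪ {v}).card ≤ r + 2 := by
          have h1 := Finset.card_union_le (insert u C) {v}
          have h2 := Finset.card_insert_le u C
          rw [Finset.card_singleton] at h1
          omega
        refine Packing.of_del hr hP (conn_singleton v) hdisj he ?_
        rcases Nat.eq_zero_or_pos K with rfl | hK
        · exact packing_zero r
        have h1 := card_adjPairs_del (G := G) (insert u C ∪ {v})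
        rw [hN] at h1
        have h2 : (insert u C ∪ {v}).card * N ≤ (r + 2) * N := Nat.mul_le_mul_right _ hMc
        have h3 : 2 * (K * (r + 2)) * N ≤ (G.del (insert u C ∪ {v})).adjPairs.card := by omega
        refine ihK _ (adjPairs_nonempty_iff.1 (Finset.card_pos.1 (lt_of_lt_of_le ?_ h3))) ?_
        · positivity
        · refine le_trans (Nat.mul_le_mul_left _ ?_) h3
          exact hN ▸ Finset.card_le_card active_del_subset
      · have h1 := card_adjPairs_quot huv
        have h2 := Finset.card_lt_card (active_quot_update_ssubset huv)
        rw [hN] at h2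
        refine Packing.of_contract hr huv (ih _ h2 _ ?_ ?_ rfl)
        · refine adjPairs_nonempty_iff.1 (Finset.card_pos.1 ?_)
          omega
        · have h4 : 2 * ((K + 1) * (r + 2)) * (G.quot (Function.update id v u)).active.card +
              2 * ((K + 1) * (r + 2)) ≤ 2 * ((K + 1) * (r + 2)) * N := by
            rw [← Nat.mul_succ]; exact Nat.mul_le_mul_left _ h2
          rw [hN] at hd
          have h5 : r + 2 ≤ (K + 1) * (r + 2) := Nat.le_mul_of_pos_left _ (Nat.succ_pos K)
          omega

/-! ### Sets of small radius in the absence of small models -/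

variable (G)

/-- Every vertex of `A` lies with `c` in a connected subset of `A` with at most `R + 1` vertices. -/
def Near (c : V) (R : ℕ) (A : Finset V) : Prop :=
  c ∈ A ∧ ∀ x ∈ A, ∃ P ⊆ A, G.Conn P ∧ c ∈ P ∧ x ∈ P ∧ P.card ≤ R + 1

/-- The map `l` is the depth function of a spanning tree of `B` with root `c`. -/
def Layered (c : V) (l : V → ℕ) (B : Finset V) : Prop :=
  c ∈ B ∧ ∀ v ∈ B, (v = c ∧ l v = 0) ∨ ∃ u ∈ B, 0 < G.mult u v ∧ l v = l u + 1

/-- Two vertices are at distance at most `i`. -/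
def Reach : ℕ → V → V → Prop
  | 0, x, y => x = y
  | i + 1, x, y => ∃ z, Reach i x z ∧ (z = y ∨ 0 < G.mult z y)

/-- The distance of a vertex from a set. -/
noncomputable def distTo (C : Finset V) (v : V) : ℕ := sInf {i | ∃ c ∈ C, G.Reach i c v}

variable {G}

/-- All the connecting sets share `c`, so each vertex of `X` adds at most `R` new vertices. -/
theorem Near.exists_conn_superset {c : V} {R : ℕ} {A : Finset V} (h : G.Near c R A)
    (X : Finset V) (hX : X ⊆ A) :
    ∃ P ⊆ A, G.Conn P ∧ c ∈ P ∧ X ⊆ P ∧ P.card ≤ 1 + R * X.card := by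
  induction X using Finset.induction_on with
  | empty =>
    exact ⟨{c}, by simpa using h.1, conn_singleton c, by simp, by simp, by simp⟩
  | insert x X hx ih =>
    obtain ⟨P, hPA, hP, hcP, hXP, hPc⟩ := ih ((Finset.subset_insert _ _).trans hX)
    obtain ⟨Q, hQA, hQ, hcQ, hxQ, hQc⟩ := h.2 x (hX (Finset.mem_insert_self _ _))
    refine ⟨P ∪ Q, Finset.union_subset hPA hQA, hP.union hQ hcP hcQ,
      Finset.mem_union_left _ hcP, Finset.insert_subset (Finset.mem_union_right _ hxQ)
        (hXP.trans Finset.subset_union_left), ?_⟩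
    have h1 := Finset.card_union_add_card_inter P Q
    have h2 : 0 < (P ∩ Q).card := Finset.card_pos.2 ⟨c, Finset.mem_inter.2 ⟨hcP, hcQ⟩⟩
    rw [Finset.card_insert_of_notMem hx, mul_add]
    omega

/-- Each adjacent pair contributes at least one edge, so `r` pairs always suffice. -/
theorem exists_few_pairs {A B : Finset V} {r : ℕ} (h : r ≤ G.edges A B) :
    ∃ T ⊆ A ×ˢ B, T.card ≤ r ∧ (∀ q ∈ T, 0 < G.mult q.1 q.2) ∧
      r ≤ ∑ q ∈ T, G.mult q.1 q.2 := by
  set S := (A ×ˢ B).filter fun q => 0 < G.mult q.1 q.2 with hS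
  have hSsum : G.edges A B = ∑ q ∈ S, G.mult q.1 q.2 := by
    rw [edges, ← Finset.sum_product', hS]
    symm
    refine Finset.sum_filter_of_ne fun q _ hq => Nat.pos_of_ne_zero hq
  by_cases hc : S.card ≤ r
  · exact ⟨S, Finset.filter_subset _ _, hc, fun q hq => (Finset.mem_filter.1 hq).2, hSsum ▸ h⟩
  · obtain ⟨T, hT, hTc⟩ := Finset.exists_subset_card_eq (not_le.1 hc).le
    refine ⟨T, hT.trans (Finset.filter_subset _ _), hTc.le,
      fun q hq => (Finset.mem_filter.1 (hT hq)).2, ?_⟩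
    rw [← hTc, Finset.card_eq_sum_ones]
    exact Finset.sum_le_sum fun q hq => (Finset.mem_filter.1 (hT hq)).2

theorem sum_pairs_le_edges {A B : Finset V} {T : Finset (V × V)} (hT : T ⊆ A ×ˢ B) :
    ∑ q ∈ T, G.mult q.1 q.2 ≤ G.edges A B := by
  rw [edges, ← Finset.sum_product']
  exact Finset.sum_le_sum_of_subset hT

/-- Given `r` edges between the two sets, keep only connections from the centres to the ends of at
most `r` adjacent pairs. This is a model on at most `2 + R * r + R' * r` vertices. -/
theorem NoSmallModel.edges_lt {r s : ℕ} (h : G.NoSmallModel r s) {c c' : V} {R R' : ℕ}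
    {A B : Finset V} (hA : G.Near c R A) (hB : G.Near c' R' B) (hAB : Disjoint A B)
    (hs : 2 + R * r + R' * r ≤ s) : G.edges A B < r := by
  by_contra! hr
  obtain ⟨T, hT, hTc, -, hTr⟩ := exists_few_pairs hr
  obtain ⟨P, hPA, hP, -, hXP, hPc⟩ := hA.exists_conn_superset (T.image Prod.fst) (by
    intro x hx
    obtain ⟨q, hq, rfl⟩ := Finset.mem_image.1 hx
    exact (Finset.mem_product.1 (hT hq)).1)
  obtain ⟨Q, hQB, hQ, -, hXQ, hQc⟩ := hB.exists_conn_superset (T.image Prod.snd) (by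
    intro x hx
    obtain ⟨q, hq, rfl⟩ := Finset.mem_image.1 hx
    exact (Finset.mem_product.1 (hT hq)).2)
  have h1 : R * (T.image Prod.fst).card ≤ R * r :=
    Nat.mul_le_mul_left _ (Finset.card_image_le.trans hTc)
  have h2 : R' * (T.image Prod.snd).card ≤ R' * r :=
    Nat.mul_le_mul_left _ (Finset.card_image_le.trans hTc)
  have h3 := h P Q hP hQ (Finset.disjoint_of_subset_left hPA
    (Finset.disjoint_of_subset_right hQB hAB)) (by omega)
  have h4 : T ⊆ P ×ˢ Q := fun q hq => Finset.mem_product.2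
    ⟨hXP (Finset.mem_image_of_mem _ hq), hXQ (Finset.mem_image_of_mem _ hq)⟩
  have h5 := sum_pairs_le_edges (G := G) h4
  omega

theorem near_singleton (v : V) : G.Near v 0 {v} :=
  ⟨by simp, fun x hx => ⟨{v}, le_rfl, conn_singleton v, by simp, hx, by simp⟩⟩

theorem Near.conn {c : V} {R : ℕ} {A : Finset V} (h : G.Near c R A) : G.Conn A := by
  obtain ⟨P, hPA, hP, -, hAP, -⟩ := h.exists_conn_superset A le_rfl
  rwa [hPA.antisymm hAP] at hP

/-- Following parents from a vertex reaches the root through strictly smaller depths. -/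
theorem Layered.near {c : V} {l : V → ℕ} {B : Finset V} (h : G.Layered c l B) (i : ℕ) :
    G.Near c i (B.filter (l · ≤ i)) := by
  have hc : l c = 0 := by
    rcases h.2 c h.1 with ⟨-, h0⟩ | ⟨u, hu, huc, hl⟩
    · exact h0
    · have key : ∀ k, ∀ v ∈ B, l v = k → ∃ w ∈ B, w = c ∧ l w = 0 := by
        intro k
        induction k with
        | zero =>
          intro v hv hk
          rcases h.2 v hv with ⟨rfl, h0⟩ | ⟨u, -, -, hl⟩
          · exact ⟨v, hv, rfl, h0⟩
          · omega
        | succ k ih =>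
          intro v hv hk
          rcases h.2 v hv with ⟨rfl, h0⟩ | ⟨u, hu, -, hl⟩
          · exact ⟨v, hv, rfl, h0⟩
          · exact ih u hu (by omega)
      obtain ⟨w, -, rfl, h0⟩ := key _ c h.1 rfl
      exact h0
  refine ⟨Finset.mem_filter.2 ⟨h.1, by omega⟩, fun x hx => ?_⟩
  have key : ∀ k ≤ i, ∀ v ∈ B, l v = k → ∃ P ⊆ B.filter (l · ≤ i),
      G.Conn P ∧ c ∈ P ∧ v ∈ P ∧ P.card ≤ k + 1 := by
    intro k
    induction k with
    | zero =>
      intro hk v hv hl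
      rcases h.2 v hv with ⟨rfl, -⟩ | ⟨u, -, -, hl'⟩
      · exact ⟨{v}, by simp [hv, hl], conn_singleton v, by simp, by simp, by simp⟩
      · omega
    | succ k ih =>
      intro hk v hv hl
      rcases h.2 v hv with ⟨rfl, h0⟩ | ⟨u, hu, huv, hl'⟩
      · omega
      · obtain ⟨P, hPB, hP, hcP, huP, hPc⟩ := ih (by omega) u hu (by omega)
        refine ⟨insert v P, Finset.insert_subset (Finset.mem_filter.2 ⟨hv, by omega⟩) hPB,
          hP.insert huP huv, Finset.mem_insert_of_mem hcP, Finset.mem_insert_self _ _, ?_⟩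
        have := Finset.card_insert_le v P
        omega
  obtain ⟨hxB, hxi⟩ := Finset.mem_filter.1 hx
  obtain ⟨P, h1, h2, h3, h4, h5⟩ := key _ hxi x hxB rfl
  exact ⟨P, h1, h2, h3, h4, by omega⟩

theorem Layered.near_of_le {c : V} {l : V → ℕ} {B : Finset V} (h : G.Layered c l B) {R : ℕ}
    (hR : ∀ v ∈ B, l v ≤ R) : G.Near c R B := by
  have := h.near R
  rwa [Finset.filter_true_of_mem hR] at this

/-- A set in which no connected subset has `r` vertices spans few edges at each vertex. -/
theorem edges_singleton_le {r : ℕ} (hr : 0 < r) {S : Finset V}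
    (hm : ∀ x ∈ S, ∀ y ∈ S, G.mult x y ≤ r - 1)
    (hS : ∀ Q ⊆ S, G.Conn Q → Q.card ≠ r) {v : V} (hv : v ∈ S) :
    G.edges {v} S ≤ (r - 2) * (r - 1) := by
  -- A largest connected set through `v` with at most `r` vertices has fewer than `r`, so it cannot
  -- be extended and contains all neighbours of `v` in `S`, at most `r - 2` of them.
  obtain ⟨Q, hQ, hmax⟩ := Finset.exists_max_image
    (S.powerset.filter fun Q => G.Conn Q ∧ v ∈ Q ∧ Q.card ≤ r) Finset.card
    ⟨{v}, by simp [hv, conn_singleton]; omega⟩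
  rw [Finset.mem_filter, Finset.mem_powerset] at hQ
  obtain ⟨hQS, hQ, hvQ, hQr⟩ := hQ
  have hlt : Q.card < r := lt_of_le_of_ne hQr (hS Q hQS hQ)
  have hout : ∀ y ∈ S, y ∉ Q → G.mult v y = 0 := by
    intro y hy hyQ
    by_contra hpos
    have := hmax (insert y Q) (by
      rw [Finset.mem_filter, Finset.mem_powerset]
      refine ⟨Finset.insert_subset hy hQS, hQ.insert hvQ (Nat.pos_of_ne_zero hpos),
        Finset.mem_insert_of_mem hvQ, ?_⟩
      rw [Finset.card_insert_of_notMem hyQ]; omega)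
    rw [Finset.card_insert_of_notMem hyQ] at this
    omega
  rw [edges, Finset.sum_singleton, ← Finset.sum_subset ((Finset.erase_subset v Q).trans hQS)]
  · refine (Finset.sum_le_card_nsmul _ _ (r - 1) fun y hy =>
      hm v hv y (hQS (Finset.mem_of_mem_erase hy))).trans ?_
    rw [Finset.card_erase_of_mem hvQ, smul_eq_mul]
    exact Nat.mul_le_mul_right _ (by omega)
  · intro y hy hyQ
    by_cases hyv : y = v
    · rw [hyv, G.diag]
    · exact hout y hy fun h => hyQ (Finset.mem_erase.2 ⟨hyv, h⟩)

/-- Per vertex there are at most `r - 1` edges to lower layers and `(r - 2) * (r - 1)` within its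
own layer. Edges to higher layers are lower edges seen from the other end. As `edges B B` counts
each edge twice, the total per vertex is `2 * (r - 1) + (r - 2) * (r - 1) = r * (r - 1)`. -/
theorem Layered.edges_self_le {r s : ℕ} (hr : 2 ≤ r) (hns : G.NoSmallModel r s) {c : V}
    {l : V → ℕ} {B : Finset V} (h : G.Layered c l B) {R : ℕ} (hR : ∀ v ∈ B, l v ≤ R)
    (hs : 2 + R * r ≤ s) : G.edges B B ≤ B.card * (r * (r - 1)) := by
  have hm : ∀ x y, G.mult x y ≤ r - 1 := by
    intro x y
    by_cases hxy : x = y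
    · rw [hxy, G.diag]; exact Nat.zero_le _
    · have := hns.edges_lt (near_singleton x) (near_singleton y) (by simpa using hxy)
        (by omega)
      rw [edges_singleton] at this
      omega
  have hlow : ∀ v ∈ B, G.edges {v} (B.filter (l · < l v)) ≤ r - 1 := by
    intro v hv
    rcases Nat.eq_zero_or_pos (l v) with h0 | hpos
    · simp [h0, edges]
    · have hset : B.filter (l · < l v) = B.filter (l · ≤ l v - 1) := by
        refine Finset.filter_congr fun x _ => by omega
      rw [hset]
      have hle : (l v - 1) * r ≤ R * r := Nat.mul_le_mul_right _ (by have := hR v hv; omega)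
      have := hns.edges_lt (near_singleton v) (h.near (l v - 1)) (by
        simp; omega) (by omega)
      omega
  have hmid : ∀ v ∈ B, G.edges {v} (B.filter (l · = l v)) ≤ (r - 2) * (r - 1) := by
    intro v hv
    refine edges_singleton_le (by omega) (fun x _ y _ => hm x y) ?_ (by simp [hv])
    intro Q hQ hQc hQr
    have hlQ : ∀ y ∈ Q, y ∈ B ∧ l y = l v := fun y hy => Finset.mem_filter.1 (hQ hy)
    rcases Nat.eq_zero_or_pos (l v) with h0 | hpos
    · have : Q ⊆ {c} := by
        intro y hy
        rcases h.2 y (hlQ y hy).1 with ⟨rfl, -⟩ | ⟨u, -, -, hl⟩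
        · simp
        · have := (hlQ y hy).2; omega
      have := Finset.card_le_card this
      simp at this
      omega
    -- A connected set of `r` vertices within one layer would form a small model with a connected
    -- set below it through their parents.
    · have hparent : ∀ y ∈ Q, ∃ u ∈ B.filter (l · ≤ l v - 1), 0 < G.mult u y := by
        intro y hy
        rcases h.2 y (hlQ y hy).1 with ⟨-, h0⟩ | ⟨u, hu, huy, hl⟩
        · have := (hlQ y hy).2; omega
        · exact ⟨u, Finset.mem_filter.2 ⟨hu, by have := (hlQ y hy).2; omega⟩, huy⟩
      choose! f hf hfpos using hparent
      obtain ⟨P, hPA, hP, -, hXP, hPc⟩ := (h.near (l v - 1)).exists_conn_superset (Q.image f) (by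
        intro x hx
        obtain ⟨y, hy, rfl⟩ := Finset.mem_image.1 hx
        exact hf y hy)
      have hdisj : Disjoint P Q := by
        rw [Finset.disjoint_left]
        intro x hx hx'
        have h1 := (Finset.mem_filter.1 (hPA hx)).2
        have h2 := (hlQ x hx').2
        omega
      have h1 : (l v - 1) * (Q.image f).card + r ≤ R * r := by
        have h2 : (l v - 1) * (Q.image f).card ≤ (l v - 1) * r :=
          Nat.mul_le_mul_left _ (hQr ▸ Finset.card_image_le)
        have h3 : (l v - 1 + 1) * r ≤ R * r := Nat.mul_le_mul_right _ (by have := hR v hv; omega)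
        rw [add_mul, one_mul] at h3
        omega
      have h2 := hns P Q hP hQc hdisj (by omega)
      have h3 : r ≤ G.edges P Q := by
        rw [← hQr, Finset.card_eq_sum_ones, edges, Finset.sum_comm]
        refine Finset.sum_le_sum fun y hy => ?_
        exact (hfpos y hy).trans_le (Finset.single_le_sum (f := fun x => G.mult x y)
          (fun _ _ => Nat.zero_le _) (hXP (Finset.mem_image_of_mem f hy)))
      omega
  have hsplit : G.edges B B = ∑ v ∈ B, (G.edges {v} (B.filter (l · < l v)) +
      G.edges {v} (B.filter (l · = l v)) + G.edges {v} (B.filter (l v < l ·))) := by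
    refine Finset.sum_congr rfl fun v _ => ?_
    simp only [edges, Finset.sum_singleton, Finset.sum_filter, ← Finset.sum_add_distrib]
    refine Finset.sum_congr rfl fun y _ => ?_
    rcases lt_trichotomy (l y) (l v) with h | h | h
    · simp [h, h.ne, h.not_gt]
    · simp [h]
    · simp [h, h.ne', h.not_gt]
  have hswap : ∑ v ∈ B, G.edges {v} (B.filter (l v < l ·)) =
      ∑ v ∈ B, G.edges {v} (B.filter (l · < l v)) := by
    simp only [edges, Finset.sum_singleton, Finset.sum_filter]
    rw [Finset.sum_comm]
    simp_rw [G.symm]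
  rw [hsplit, Finset.sum_add_distrib, hswap, Finset.sum_add_distrib]
  have h1 := Finset.sum_le_card_nsmul B _ _ hlow
  have h2 := Finset.sum_le_card_nsmul B _ _ hmid
  rw [smul_eq_mul] at h1 h2
  obtain ⟨k, rfl⟩ := Nat.exists_eq_add_of_le hr
  have e1 : 2 + k - 1 = k + 1 := by omega
  have e2 : 2 + k - 2 = k := by omega
  rw [e1] at h1 h2 ⊢
  rw [e2] at h2
  nlinarith

theorem edges_add_edges_compl (A B : Finset V) :
    G.edges A B + G.edges A Bᶜ = ∑ v ∈ A, G.deg v := by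
  rw [edges, edges, ← Finset.sum_add_distrib]
  exact Finset.sum_congr rfl fun v _ => Finset.sum_add_sum_compl B _

/-- Of at least `(r + 1) * (r - 1)` edge ends per vertex, on average at most `r * (r - 1)` stay
inside. -/
theorem Layered.le_edges_compl {r s : ℕ} (hr : 2 ≤ r) (hns : G.NoSmallModel r s) {c : V}
    {l : V → ℕ} {B : Finset V} (h : G.Layered c l B) {R : ℕ} (hR : ∀ v ∈ B, l v ≤ R)
    (hs : 2 + R * r ≤ s) (hdeg : ∀ v ∈ B, (r + 1) * (r - 1) ≤ G.deg v) :
    B.card * (r - 1) ≤ G.edges B Bᶜ := by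
  have h1 := h.edges_self_le hr hns hR hs
  have h2 : _ = B.sum G.deg := edges_add_edges_compl (G := G) B B
  have h3 := Finset.card_nsmul_le_sum B _ _ hdeg
  rw [smul_eq_mul, add_mul, mul_add, one_mul] at h3
  omega

/-! ### Distances, ball growth and cells -/

theorem Reach.mono {i j : ℕ} (hij : i ≤ j) {x y : V} (h : G.Reach i x y) : G.Reach j x y := by
  induction hij with
  | refl => exact h
  | step _ ih => exact ⟨y, ih, .inl rfl⟩

theorem Reach.trans {i j : ℕ} {x y z : V} (h : G.Reach i x y) (h' : G.Reach j y z) :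
    G.Reach (i + j) x z := by
  induction j generalizing z with
  | zero => obtain rfl : y = z := h'; exact h
  | succ j ih => obtain ⟨a, ha, haz⟩ := h'; exact ⟨a, ih ha, haz⟩

theorem Reach.symm {i : ℕ} {x y : V} (h : G.Reach i x y) : G.Reach i y x := by
  induction i generalizing y with
  | zero => exact Eq.symm h
  | succ i ih =>
    obtain ⟨z, hz, hzy⟩ := h
    have h1 : G.Reach 1 y z := ⟨y, rfl, hzy.imp Eq.symm fun h => G.symm z y ▸ h⟩
    exact Nat.add_comm 1 i ▸ h1.trans (ih hz)

theorem Reach.mem_active {i : ℕ} {x y : V} (h : G.Reach i x y) (hx : x ∈ G.active) :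
    y ∈ G.active := by
  cases i with
  | zero => obtain rfl : x = y := h; exact hx
  | succ i =>
    obtain ⟨z, hz, rfl | hzy⟩ := h
    · exact Reach.mem_active hz hx
    · exact mem_active_right hzy

theorem distTo_le {C : Finset V} {i : ℕ} {c v : V} (hc : c ∈ C) (h : G.Reach i c v) :
    G.distTo C v ≤ i := Nat.sInf_le ⟨c, hc, h⟩

theorem exists_reach_distTo {C : Finset V} {i : ℕ} {c v : V} (hc : c ∈ C) (h : G.Reach i c v) :
    ∃ d ∈ C, G.Reach (G.distTo C v) d v :=
  Nat.sInf_mem (s := {i | ∃ c ∈ C, G.Reach i c v}) ⟨i, c, hc, h⟩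

theorem exists_parent {C : Finset V} {i : ℕ} {c v : V} (hc : c ∈ C) (h : G.Reach i c v)
    (h0 : G.distTo C v ≠ 0) : ∃ u, 0 < G.mult u v ∧ G.distTo C v = G.distTo C u + 1 ∧
      ∃ d ∈ C, G.Reach (G.distTo C u) d u := by
  obtain ⟨d, hd, hdv⟩ := exists_reach_distTo hc h
  obtain ⟨k, hk⟩ := Nat.exists_eq_succ_of_ne_zero h0
  rw [hk] at hdv
  obtain ⟨z, hz, hzv⟩ := hdv
  have hzv : 0 < G.mult z v := by
    refine hzv.resolve_left ?_
    rintro rfl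
    have := distTo_le hd hz
    omega
  obtain ⟨d', hd', hz'⟩ := exists_reach_distTo hd hz
  refine ⟨z, hzv, ?_, d', hd', hz'⟩
  have h1 := distTo_le hd hz
  have h2 : G.distTo C v ≤ G.distTo C z + 1 := distTo_le hd' ⟨z, hz', .inr hzv⟩
  omega

/-- The vertices at distance at most `i` from `c`. -/
noncomputable def ball (G : Multigraph V) (c : V) (i : ℕ) : Finset V :=
  Finset.univ.filter (G.Reach i c)

theorem mem_ball {c v : V} {i : ℕ} : v ∈ G.ball c i ↔ G.Reach i c v := by simp [ball]

theorem layered_ball (c : V) (i : ℕ) : G.Layered c (G.distTo {c}) (G.ball c i) := by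
  refine ⟨mem_ball.2 (Reach.mono (Nat.zero_le i) rfl), fun v hv => ?_⟩
  rw [mem_ball] at hv
  have hcc := Finset.mem_singleton_self c
  by_cases h0 : G.distTo {c} v = 0
  · obtain ⟨d, hd, hdv⟩ := exists_reach_distTo hcc hv
    rw [h0] at hdv
    rw [Finset.mem_singleton] at hd
    exact .inl ⟨hd ▸ Eq.symm hdv, h0⟩
  · obtain ⟨u, huv, hl, d, hd, hdu⟩ := exists_parent hcc hv h0
    rw [Finset.mem_singleton] at hd
    subst hd
    refine .inr ⟨u, mem_ball.2 (hdu.mono ?_), huv, hl⟩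
    have := distTo_le hcc hv
    omega

/-- At least `r - 1` edges per vertex leave the ball, while each outside vertex receives at most `r
- 1` of them. Hence the next sphere is at least as large as the ball. -/
theorem two_pow_le_card_ball {r s : ℕ} (hr : 2 ≤ r) (hns : G.NoSmallModel r s)
    (hdeg : ∀ v ∈ G.active, (r + 1) * (r - 1) ≤ G.deg v) {c : V} (hc : c ∈ G.active) {i : ℕ}
    (hs : 2 + i * r ≤ s) : 2 ^ i ≤ (G.ball c i).card := by
  induction i with
  | zero => exact Finset.card_pos.2 ⟨c, mem_ball.2 rfl⟩
  | succ i ih =>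
    rw [add_mul, one_mul] at hs
    have hR : ∀ v ∈ G.ball c i, G.distTo {c} v ≤ i := fun v hv =>
      distTo_le (Finset.mem_singleton_self c) (mem_ball.1 hv)
    have h1 := (layered_ball c i).le_edges_compl hr hns hR (by omega)
      (fun v hv => hdeg v ((mem_ball.1 hv).mem_active hc))
    have hsub : G.ball c i ⊆ G.ball c (i + 1) := fun v hv =>
      mem_ball.2 ((mem_ball.1 hv).mono (Nat.le_succ i))
    have h2 : G.edges (G.ball c i) (G.ball c i)ᶜ ≤
        (G.ball c (i + 1) \ G.ball c i).card * (r - 1) := by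
      rw [edges_comm, edges, ← Finset.sum_subset (s₁ := G.ball c (i + 1) \ G.ball c i)]
      · refine Finset.sum_le_card_nsmul _ _ _ fun y hy => ?_
        have := hns.edges_lt (near_singleton y) ((layered_ball c i).near_of_le hR)
          (by simpa using (Finset.mem_sdiff.1 hy).2) (by omega)
        rw [edges, Finset.sum_singleton] at this
        omega
      · intro y hy
        exact Finset.mem_compl.2 (Finset.mem_sdiff.1 hy).2
      · intro y hy hy'
        refine Finset.sum_eq_zero fun x hx => ?_
        by_contra hpos
        refine hy' (Finset.mem_sdiff.2 ⟨mem_ball.2 ⟨x, mem_ball.1 hx, .inr ?_⟩,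
          Finset.mem_compl.1 hy⟩)
        rw [G.symm]
        exact Nat.pos_of_ne_zero hpos
    have h3 : (G.ball c i).card ≤ (G.ball c (i + 1) \ G.ball c i).card :=
      Nat.le_of_mul_le_mul_right (h1.trans h2) (by omega)
    have h4 := Finset.card_sdiff_add_card_eq_card hsub
    have h5 := ih (by omega)
    rw [pow_succ]
    omega

/-- Take a largest set of active vertices with pairwise disjoint `ρ`-balls; a vertex farther than `2
* ρ` from all of them could be added. -/
theorem exists_centres (ρ : ℕ) : ∃ C ⊆ G.active,
    (∀ c ∈ C, ∀ d ∈ C, c ≠ d → Disjoint (G.ball c ρ) (G.ball d ρ)) ∧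
    ∀ v ∈ G.active, ∃ c ∈ C, G.Reach (2 * ρ) c v := by
  obtain ⟨C, hC, hmax⟩ := Finset.exists_max_image (G.active.powerset.filter fun C =>
    ∀ c ∈ C, ∀ d ∈ C, c ≠ d → Disjoint (G.ball c ρ) (G.ball d ρ)) Finset.card ⟨∅, by simp⟩
  rw [Finset.mem_filter, Finset.mem_powerset] at hC
  refine ⟨C, hC.1, hC.2, fun v hv => ?_⟩
  by_contra! hcon
  have hvC : v ∉ C := fun h => hcon v h (Reach.mono (Nat.zero_le _) rfl)
  have hdisj : ∀ c ∈ C, Disjoint (G.ball c ρ) (G.ball v ρ) := by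
    intro c hc
    rw [Finset.disjoint_left]
    intro x hx hx'
    rw [mem_ball] at hx hx'
    have := hx.trans hx'.symm
    rw [← two_mul] at this
    exact hcon c hc this
  have := hmax (insert v C) (by
    rw [Finset.mem_filter, Finset.mem_powerset]
    refine ⟨Finset.insert_subset hv hC.1, fun c hc d hd hcd => ?_⟩
    rcases Finset.mem_insert.1 hc with hc' | hc' <;> rcases Finset.mem_insert.1 hd with hd' | hd'
    · exact (hcd (hc'.trans hd'.symm)).elim
    · exact hc' ▸ (hdisj d hd').symm
    · exact hd' ▸ hdisj c hc'
    · exact hC.2 c hc' d hd' hcd)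
  rw [Finset.card_insert_of_notMem hvC] at this
  omega

/-- Every active vertex can be assigned to a nearest centre along shortest paths. -/
theorem exists_cells {C : Finset V} (hC : C ⊆ G.active) {R : ℕ}
    (hR : ∀ v ∈ G.active, ∃ c ∈ C, G.Reach R c v) : ∃ f : V → V,
    (∀ v, v ∉ G.active → f v = v) ∧
    (∀ v ∈ G.active, f v ∈ C ∧ G.Reach (G.distTo C v) (f v) v) ∧
    ∀ c ∈ C, G.Layered c (G.distTo C) (pre f {c}) := by
  have hpar : ∀ v, ∃ u, v ∈ G.active → G.distTo C v ≠ 0 →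
      0 < G.mult u v ∧ G.distTo C v = G.distTo C u + 1 := by
    intro v
    by_cases hv : v ∈ G.active ∧ G.distTo C v ≠ 0
    · obtain ⟨c, hc, hcv⟩ := hR v hv.1
      obtain ⟨u, h1, h2, -⟩ := exists_parent hc hcv hv.2
      exact ⟨u, fun _ _ => ⟨h1, h2⟩⟩
    · exact ⟨v, fun h1 h2 => (hv ⟨h1, h2⟩).elim⟩
  choose par hpar using hpar
  -- Iterating the parent map as many times as the distance ends at a centre, so each cell is
  -- spanned by a tree of shortest paths.
  let f : V → V := fun v => par^[G.distTo C v] v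
  have hf0 : ∀ v, G.distTo C v = 0 → f v = v := fun v hv => by simp only [f, hv]; rfl
  have hfpar : ∀ v ∈ G.active, G.distTo C v ≠ 0 → f (par v) = f v := by
    intro v hv h0
    have := (hpar v hv h0).2
    simp only [f, this, Function.iterate_succ_apply]
  have hactive : ∀ v ∈ G.active, f v ∈ C ∧ G.Reach (G.distTo C v) (f v) v := by
    intro v hv
    induction hk : G.distTo C v generalizing v with
    | zero =>
      obtain ⟨c, hc, hcv⟩ := hR v hv
      obtain ⟨d, hd, hdv⟩ := exists_reach_distTo hc hcv
      rw [hk] at hdv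
      obtain rfl : d = v := hdv
      rw [hf0 d hk]
      exact ⟨hd, rfl⟩
    | succ k ih =>
      have h0 : G.distTo C v ≠ 0 := by omega
      obtain ⟨h1, h2⟩ := hpar v hv h0
      have h3 := ih (par v) (mem_active_left h1) (by omega)
      rw [hfpar v hv h0] at h3
      exact ⟨h3.1, par v, h3.2, .inr h1⟩
  have hinactive : ∀ v, v ∉ G.active → f v = v := by
    intro v hv
    -- No centre reaches an inactive vertex, so its distance is the default `sInf ∅ = 0`.
    refine hf0 v (Nat.sInf_eq_zero.2 (.inr ?_))
    rw [Set.eq_empty_iff_forall_notMem]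
    rintro i ⟨c, hc, hcv⟩
    exact hv (hcv.mem_active (hC hc))
  have hcell : ∀ c ∈ C, ∀ v, f v = c → v ∈ G.active := by
    intro c hc v hv
    by_contra h
    rw [hinactive v h] at hv
    exact h (hv ▸ hC hc)
  refine ⟨f, hinactive, hactive, fun c hc => ⟨?_, fun v hv => ?_⟩⟩
  · rw [mem_pre, Finset.mem_singleton]
    refine hf0 c ?_
    have : G.distTo C c ≤ 0 := distTo_le hc (rfl : G.Reach 0 c c)
    omega
  · rw [mem_pre, Finset.mem_singleton] at hv
    have hva := hcell c hc v hv
    by_cases h0 : G.distTo C v = 0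
    · exact .inl ⟨(hf0 v h0).symm.trans hv, h0⟩
    · obtain ⟨h1, h2⟩ := hpar v hva h0
      exact .inr ⟨par v, by rw [mem_pre, Finset.mem_singleton, hfpar v hva h0, hv], h1, h2⟩

theorem pre_compl (h : V → V) (A : Finset V) : pre h Aᶜ = (pre h A)ᶜ := by
  ext x; simp [mem_pre]

/-- The bound `2 + 4 * ρ * r` is the size of a model taken from two cells of radius `2 * ρ`. So two
cells span at most `r - 1` edges, and a cell with at least `2 ^ ρ` vertices, sending out `r - 1`
edges per vertex, has at least `2 ^ ρ` neighbouring cells. -/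
theorem packing_of_deg {r K ρ : ℕ} (hr : 2 ≤ r) (hρ : 2 * (K * (r + 2)) ≤ 2 ^ ρ)
    (hns : G.NoSmallModel r (2 + 4 * ρ * r)) (hne : G.active.Nonempty)
    (hdeg : ∀ v ∈ G.active, (r + 1) * (r - 1) ≤ G.deg v) : G.Packing K r := by
  obtain ⟨C, hCa, hCdisj, hCreach⟩ := exists_centres (G := G) ρ
  obtain ⟨f, hf1, hf2, hf3⟩ := exists_cells hCa hCreach
  have hs : 2 + 2 * ρ * r ≤ 2 + 4 * ρ * r := by
    have : 2 * ρ * r ≤ 4 * ρ * r := by gcongr; omega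
    omega
  have hcell : ∀ c ∈ C, ∀ v ∈ pre f {c}, v ∈ G.active := by
    intro c hc v hv
    by_contra h
    rw [mem_pre, Finset.mem_singleton, hf1 v h] at hv
    exact h (hv ▸ hCa hc)
  have hdist : ∀ v ∈ G.active, G.distTo C v ≤ 2 * ρ := by
    intro v hv
    obtain ⟨c, hc, hcv⟩ := hCreach v hv
    exact distTo_le hc hcv
  have hlarge : ∀ c ∈ C, 2 ^ ρ ≤ (pre f {c}).card := by
    intro c hc
    have h1 : 2 + ρ * r ≤ 2 + 4 * ρ * r := by
      have : ρ * r ≤ 4 * ρ * r := by gcongr; omega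
      omega
    refine (two_pow_le_card_ball hr hns hdeg (hCa hc) h1).trans (Finset.card_le_card ?_)
    -- A vertex within `ρ` of `c` is at most as far from its own centre, so a different centre would
    -- have a `ρ`-ball meeting that of `c`.
    intro v hv
    have hv' := mem_ball.1 hv
    obtain ⟨h2, h3⟩ := hf2 v (hv'.mem_active (hCa hc))
    rw [mem_pre, Finset.mem_singleton]
    by_contra hne
    exact Finset.disjoint_left.1 (hCdisj _ h2 c hc hne)
      (mem_ball.2 (h3.mono (distTo_le hc hv'))) hv
  have hnear : ∀ c ∈ C, G.Near c (2 * ρ) (pre f {c}) := fun c hc =>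
    (hf3 c hc).near_of_le fun v hv => hdist v (hcell c hc v hv)
  have hQactive : ∀ a b, 0 < (G.quot f).mult a b → a ∈ C ∧ b ∈ C := by
    intro a b hab
    obtain ⟨-, x, y, rfl, rfl, hxy⟩ := quot_mult_pos.1 hab
    exact ⟨(hf2 x (mem_active_left hxy)).1, (hf2 y (mem_active_right hxy)).1⟩
  have hQmult : ∀ a b, (G.quot f).mult a b ≤ r - 1 := by
    intro a b
    rcases Nat.eq_zero_or_pos ((G.quot f).mult a b) with h0 | hpos
    · omega
    · obtain ⟨ha, hb⟩ := hQactive a b hpos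
      have hab : Disjoint {a} {b} := Finset.disjoint_singleton.2 (ne_of_mult_pos hpos)
      have := hns.edges_lt (hnear a ha) (hnear b hb) (disjoint_pre hab) (by linarith)
      rw [← edges_quot hab, edges_singleton] at this
      omega
  have hnbr : ∀ c ∈ C,
      2 ^ ρ ≤ (Finset.univ.filter fun b => 0 < (G.quot f).mult c b).card := by
    intro c hc
    have h1 := (hf3 c hc).le_edges_compl hr hns
      (fun v hv => hdist v (hcell c hc v hv)) hs (fun v hv => hdeg v (hcell c hc v hv))
    rw [← pre_compl, ← edges_quot disjoint_compl_right] at h1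
    have h2 : (G.quot f).edges {c} {c}ᶜ ≤
        (Finset.univ.filter fun b => 0 < (G.quot f).mult c b).card * (r - 1) := by
      refine (edges_mono le_rfl (Finset.subset_univ _)).trans ?_
      rw [edges, Finset.sum_singleton, ← Finset.sum_filter_of_ne (p := fun b =>
        0 < (G.quot f).mult c b) (fun b _ hb => Nat.pos_of_ne_zero hb)]
      exact Finset.sum_le_card_nsmul _ _ _ fun b _ => hQmult c b
    exact (hlarge c hc).trans (Nat.le_of_mul_le_mul_right (h1.trans h2) (by omega))
  have hQne : (G.quot f).active.Nonempty := by
    obtain ⟨x, hx⟩ := hne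
    obtain ⟨c, hc, -⟩ := hCreach x hx
    obtain ⟨b, hb⟩ := Finset.card_pos.1 ((Nat.two_pow_pos ρ).trans_le (hnbr c hc))
    exact ⟨c, mem_active_left (Finset.mem_filter.1 hb).2⟩
  refine Packing.of_quot (by omega) (packing_of_dense (by omega) K (G.quot f) hQne ?_)
    (fun a ⟨z, hz⟩ => ?_)
  · have h1 : (G.quot f).adjPairs.card =
        ∑ c, (Finset.univ.filter fun b => 0 < (G.quot f).mult c b).card := by
      rw [adjPairs, Finset.card_filter, ← Finset.univ_product_univ, Finset.sum_product]
      simp_rw [Finset.card_filter]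
    rw [h1, mul_comm, ← smul_eq_mul]
    refine le_trans ?_ (Finset.sum_le_sum_of_subset (Finset.subset_univ (G.quot f).active))
    refine Finset.card_nsmul_le_sum _ _ _ fun c hc => hρ.trans (hnbr c ?_)
    obtain ⟨b, hb⟩ := mem_active.1 hc
    exact (hQactive c b hb).1
  · by_cases hza : z ∈ G.active
    · rw [mem_pre, Finset.mem_singleton] at hz
      exact (hnear a (hz ▸ (hf2 z hza).1)).conn
    · have hza' := hf1 z hza
      rw [mem_pre, Finset.mem_singleton, hza'] at hz
      subst hz
      have : pre f {z} = {z} := by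
        ext x
        rw [mem_pre, Finset.mem_singleton, Finset.mem_singleton]
        refine ⟨fun hx => ?_, fun hx => hx ▸ hza'⟩
        by_cases hxa : x ∈ G.active
        · exact (hza (hx ▸ hCa (hf2 x hxa).1)).elim
        · rwa [hf1 x hxa] at hx
      rw [this]
      exact conn_singleton z

/-! ### Absorbing low-degree vertices into stars -/

/-- In a multigraph where vertices of degree less than `d` are pairwise nonadjacent, each such
vertex can be assigned to a neighbour. -/
theorem exists_stars {d : ℕ} (hlow : ∀ x y, 0 < G.mult x y → G.deg x < d → d ≤ G.deg y) :
    ∃ h : V → V, (∀ x, d ≤ G.deg x → h x = x) ∧ (∀ x, x ∉ G.active → h x = x) ∧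
      ∀ x ∈ G.active, d ≤ G.deg (h x) ∧ (h x = x ∨ 0 < G.mult (h x) x ∧ G.deg x < d) := by
  have : ∀ x, ∃ a, (d ≤ G.deg x → a = x) ∧ (x ∉ G.active → a = x) ∧
      (x ∈ G.active → d ≤ G.deg a ∧ (a = x ∨ 0 < G.mult a x ∧ G.deg x < d)) := by
    intro x
    by_cases hx : d ≤ G.deg x
    · exact ⟨x, fun _ => rfl, fun _ => rfl, fun _ => ⟨hx, .inl rfl⟩⟩
    · by_cases hxa : x ∈ G.active
      · obtain ⟨y, hy⟩ := mem_active.1 hxa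
        exact ⟨y, fun h => (hx h).elim, fun h => (h hxa).elim,
          fun _ => ⟨hlow x y hy (not_le.1 hx), .inr ⟨G.symm x y ▸ hy, not_le.1 hx⟩⟩⟩
      · exact ⟨x, fun _ => rfl, fun _ => rfl, fun h => (hxa h).elim⟩
  choose h h1 h2 h3 using this
  exact ⟨h, h1, h2, h3⟩

section Stars

variable {d : ℕ} {h : V → V}

/-- A connected set of stars contains a connected vertex set through all of the centres. -/
theorem exists_conn_of_stars (hlow : ∀ x y, 0 < G.mult x y → G.deg x < d → d ≤ G.deg y)
    (h1 : ∀ x, d ≤ G.deg x → h x = x)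
    (h3 : ∀ x ∈ G.active, d ≤ G.deg (h x) ∧ (h x = x ∨ 0 < G.mult (h x) x ∧ G.deg x < d))
    {P : Finset V} (hP : (G.quot h).Conn P) (hfix : ∀ x ∈ P, h x = x) :
    ∃ Q, P ⊆ Q ∧ Q ⊆ pre h P ∧ G.Conn Q ∧ Q.card + 1 ≤ 2 * P.card := by
  obtain ⟨p, hp⟩ := hP.1
  obtain ⟨A, hA, hmax⟩ := Finset.exists_max_image (P.powerset.filter fun A => A.Nonempty ∧
    ∃ Q, A ⊆ Q ∧ Q ⊆ pre h P ∧ G.Conn Q ∧ Q.card + 1 ≤ 2 * A.card) Finset.card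
    ⟨{p}, by
      rw [Finset.mem_filter, Finset.mem_powerset]
      refine ⟨by simpa using hp, by simp, {p}, le_rfl, ?_, conn_singleton p, by simp⟩
      rw [Finset.singleton_subset_iff, mem_pre, hfix p hp]
      exact hp⟩
  rw [Finset.mem_filter, Finset.mem_powerset] at hA
  obtain ⟨hAP, hAne, Q, hAQ, hQP, hQ, hQc⟩ := hA
  by_cases hAeq : A = P
  · subst hAeq
    exact ⟨Q, hAQ, hQP, hQ, hQc⟩
  exfalso
  obtain ⟨a, ha, b, hb, hbA, hab⟩ := hP.exists_edge hAP hAne hAeq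
  obtain ⟨-, x, y, rfl, rfl, hxy⟩ := quot_mult_pos.1 hab
  -- Low-degree vertices are pairwise nonadjacent, so an edge between two stars has at most one end
  -- that is a leaf. Reaching a new centre therefore costs at most that leaf besides the centre.
  have key : ∃ Q', insert (h y) Q ⊆ Q' ∧ Q' ⊆ pre h P ∧ G.Conn Q' ∧ Q'.card ≤ Q.card + 2 := by
    have hhx : h x ∈ Q := hAQ ha
    have hxP : x ∈ pre h P := mem_pre.2 (hAP ha)
    have hyP : y ∈ pre h P := mem_pre.2 hb
    rcases (h3 y (mem_active_right hxy)).2 with hy | ⟨hy, hyd⟩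
    · rcases (h3 x (mem_active_left hxy)).2 with hx | ⟨hx, -⟩
      · rw [hx] at hhx
        refine ⟨insert y Q, by rw [hy], Finset.insert_subset hyP hQP, hQ.insert hhx hxy, ?_⟩
        have := Finset.card_insert_le y Q
        omega
      · refine ⟨insert y (insert x Q), ?_, Finset.insert_subset hyP
          (Finset.insert_subset hxP hQP), (hQ.insert hhx hx).insert
            (Finset.mem_insert_self _ _) hxy, ?_⟩
        · rw [hy]; exact Finset.insert_subset_insert _ (Finset.subset_insert _ _)
        · have := Finset.card_insert_le y (insert x Q)
          have := Finset.card_insert_le x Q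
          omega
    · have hx := h1 x (hlow y x (G.symm x y ▸ hxy) hyd)
      rw [hx] at hhx
      refine ⟨insert (h y) (insert y Q), Finset.insert_subset_insert _ (Finset.subset_insert _ _),
        Finset.insert_subset (mem_pre.2 (by rw [hfix _ hb]; exact hb))
          (Finset.insert_subset hyP hQP),
        (hQ.insert hhx hxy).insert (Finset.mem_insert_self _ _) (G.symm (h y) y ▸ hy), ?_⟩
      have := Finset.card_insert_le (h y) (insert y Q)
      have := Finset.card_insert_le y Q
      omega
  obtain ⟨Q', hQQ', hQ'P, hQ', hQ'c⟩ := key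
  have hc := Finset.card_insert_of_notMem hbA
  have := hmax (insert (h y) A) (by
    rw [Finset.mem_filter, Finset.mem_powerset]
    refine ⟨Finset.insert_subset hb hAP, ⟨_, Finset.mem_insert_self _ _⟩, Q',
      (Finset.insert_subset_insert _ hAQ).trans hQQ', hQ'P, hQ', ?_⟩
    omega)
  omega

/-- A model in the quotient lifts to `G`: connecting the centres at most doubles the size, and each
of at most `r` chosen pairs adds at most one leaf. -/
theorem NoSmallModel.quot_stars {r s : ℕ} (hr : 0 < r)
    (hlow : ∀ x y, 0 < G.mult x y → G.deg x < d → d ≤ G.deg y)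
    (h1 : ∀ x, d ≤ G.deg x → h x = x)
    (h3 : ∀ x ∈ G.active, d ≤ G.deg (h x) ∧ (h x = x ∨ 0 < G.mult (h x) x ∧ G.deg x < d))
    (hns : G.NoSmallModel r (2 * s + r)) : (G.quot h).NoSmallModel r s := by
  intro P Q hP hQ hPQ hs
  by_contra! he
  have hfix : ∀ x ∈ (G.quot h).active, h x = x := by
    intro x hx
    obtain ⟨y, hy⟩ := mem_active.1 hx
    obtain ⟨-, a, b, rfl, -, hab⟩ := quot_mult_pos.1 hy
    exact h1 _ (h3 a (mem_active_left hab)).1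
  have hPf : ∀ x ∈ P, h x = x := fun x hx =>
    hfix x (hP.mem_active_of_edges_pos (hr.trans_le he) hx)
  have hQf : ∀ x ∈ Q, h x = x := fun x hx =>
    hfix x (hQ.mem_active_of_edges_pos (hr.trans_le (he.trans_eq (edges_comm _ _))) hx)
  obtain ⟨P', hPP', hP'P, hP', hP'c⟩ := exists_conn_of_stars hlow h1 h3 hP hPf
  obtain ⟨Q', hQQ', hQ'Q, hQ', hQ'c⟩ := exists_conn_of_stars hlow h1 h3 hQ hQf
  rw [edges_quot hPQ] at he
  obtain ⟨T, hT, hTc, hTpos, hTr⟩ := exists_few_pairs he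
  -- An edge between two stars has at most one end that is not a centre.
  have key : ∀ T' ⊆ T, ∃ P'' Q'', P' ⊆ P'' ∧ P'' ⊆ pre h P ∧ G.Conn P'' ∧
      Q' ⊆ Q'' ∧ Q'' ⊆ pre h Q ∧ G.Conn Q'' ∧ T' ⊆ P'' ×ˢ Q'' ∧
      P''.card + Q''.card ≤ P'.card + Q'.card + T'.card := by
    intro T'
    induction T' using Finset.induction_on with
    | empty => exact fun _ => ⟨P', Q', le_rfl, hP'P, hP', le_rfl, hQ'Q, hQ', by simp, by simp⟩
    | insert q T' hq ih =>
      intro hT'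
      obtain ⟨A, B, hA1, hA2, hA3, hB1, hB2, hB3, hAB, hABc⟩ :=
        ih ((Finset.subset_insert _ _).trans hT')
      have hqT := hT' (Finset.mem_insert_self _ _)
      obtain ⟨x, y⟩ := q
      have hxy : 0 < G.mult x y := hTpos _ hqT
      obtain ⟨hxP, hyQ⟩ := Finset.mem_product.1 (hT hqT)
      dsimp only at hxP hyQ
      have hxA : h x ∈ A := hA1 (hPP' (mem_pre.1 hxP))
      have hyB : h y ∈ B := hB1 (hQQ' (mem_pre.1 hyQ))
      rw [Finset.card_insert_of_notMem hq]
      rcases (h3 x (mem_active_left hxy)).2 with hx | ⟨hx, hxd⟩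
      · rw [hx] at hxA
        rcases (h3 y (mem_active_right hxy)).2 with hy | ⟨hy, -⟩
        · rw [hy] at hyB
          exact ⟨A, B, hA1, hA2, hA3, hB1, hB2, hB3, Finset.insert_subset
            (Finset.mem_product.2 ⟨hxA, hyB⟩) hAB, by omega⟩
        · refine ⟨A, insert y B, hA1, hA2, hA3, hB1.trans (Finset.subset_insert _ _),
            Finset.insert_subset hyQ hB2, hB3.insert hyB hy, Finset.insert_subset
              (Finset.mem_product.2 ⟨hxA, Finset.mem_insert_self _ _⟩)
              (hAB.trans (Finset.product_subset_product_right (Finset.subset_insert _ _))), ?_⟩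
          have := Finset.card_insert_le y B
          omega
      · rw [h1 y (hlow x y hxy hxd)] at hyB
        refine ⟨insert x A, B, hA1.trans (Finset.subset_insert _ _),
            Finset.insert_subset hxP hA2, hA3.insert hxA hx, hB1, hB2, hB3, Finset.insert_subset
              (Finset.mem_product.2 ⟨Finset.mem_insert_self _ _, hyB⟩)
              (hAB.trans (Finset.product_subset_product_left (Finset.subset_insert _ _))), ?_⟩
        have := Finset.card_insert_le x A
        omega
  obtain ⟨A, B, -, hA2, hA3, -, hB2, hB3, hAB, hABc⟩ := key T le_rfl
  have h4 := hns A B hA3 hB3 (Finset.disjoint_of_subset_left hA2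
    (Finset.disjoint_of_subset_right hB2 (disjoint_pre hPQ))) (by omega)
  have h5 := sum_pairs_le_edges (G := G) hAB
  omega

theorem deg_quot (a : V) : (G.quot h).deg a = G.edges (pre h {a}) (pre h {a})ᶜ := by
  rw [← pre_compl, ← edges_quot disjoint_compl_right, edges, Finset.sum_singleton, deg]
  have := Finset.sum_add_sum_compl {a} ((G.quot h).mult a)
  rw [Finset.sum_singleton, Multigraph.diag, zero_add] at this
  exact this.symm

/-- Each leaf `y` of the star at `a` has a neighbour `z ≠ a`, which is of high degree and hence lies
in another star. So the at most `r - 1` edges between `a` and `y` are charged to an edge leaving the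
star. -/
theorem le_deg_quot_stars {r : ℕ} (hr : 2 ≤ r) (hm : ∀ x y, G.mult x y ≤ r - 1)
    (hlow : ∀ x y, 0 < G.mult x y → G.deg x < d → d ≤ G.deg y)
    (htwo : ∀ u v, 0 < G.mult u v → G.deg v < d → ∃ z ≠ u, 0 < G.mult v z)
    (h1 : ∀ x, d ≤ G.deg x → h x = x)
    {a : V} (ha : h a = a) : G.deg a ≤ (r - 1) * (G.quot h).deg a := by
  rw [deg_quot, edges, Finset.mul_sum]
  have haa : a ∈ pre h {a} := by simp [mem_pre, ha]
  rw [← Finset.add_sum_erase _ _ haa, deg, ← Finset.sum_add_sum_compl (pre h {a}), add_comm]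
  refine add_le_add (Nat.le_mul_of_pos_left _ (by omega)) ?_
  rw [← Finset.add_sum_erase _ _ haa, G.diag, zero_add]
  refine Finset.sum_le_sum fun y hy => ?_
  rcases Nat.eq_zero_or_pos (G.mult a y) with h0 | hpos
  · omega
  obtain ⟨hya, hy⟩ := Finset.mem_erase.1 hy
  rw [mem_pre, Finset.mem_singleton] at hy
  have hyd : G.deg y < d := by
    by_contra hcon
    exact hya ((h1 y (not_lt.1 hcon)).symm.trans hy)
  obtain ⟨z, hza, hz⟩ := htwo a y hpos hyd
  refine (hm a y).trans (Nat.le_mul_of_pos_right _ (hz.trans_le ?_))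
  refine Finset.single_le_sum (f := G.mult y) (fun _ _ => Nat.zero_le _) ?_
  rw [Finset.mem_compl, mem_pre, Finset.mem_singleton, h1 z (hlow y z hz hyd)]
  exact hza

end Stars

/-! ### Irreducible multigraphs and the main induction -/

/-- The degree above which a vertex cannot be contracted into a neighbour. -/
def highDeg (r : ℕ) : ℕ := (r - 1) * ((r + 1) * (r - 1))

theorem packing_of_irreducible {r K ρ : ℕ} (hr : 2 ≤ r) (hρ : 2 * (K * (r + 2)) ≤ 2 ^ ρ)
    (hns : G.NoSmallModel r (2 * (2 + 4 * ρ * r) + r)) (hne : G.active.Nonempty)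
    (hout : ∀ u v, 0 < G.mult u v → 2 * highDeg r < G.edges {u, v} {u, v}ᶜ)
    (htwo : ∀ u v, 0 < G.mult u v → ∃ z ≠ u, 0 < G.mult v z) : G.Packing K r := by
  have hm : ∀ x y, G.mult x y ≤ r - 1 := by
    intro x y
    by_cases hxy : x = y
    · rw [hxy, G.diag]; exact Nat.zero_le _
    · have := hns.edges_lt (near_singleton x) (near_singleton y) (by simpa using hxy)
        (by omega)
      rw [edges_singleton] at this
      omega
  -- Two adjacent vertices of low degree would have fewer than `2 * highDeg r` edges leaving the
  -- pair.
  have hlow : ∀ x y, 0 < G.mult x y → G.deg x < highDeg r → highDeg r ≤ G.deg y := by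
    intro x y hxy hx
    have h1 := hout x y hxy
    have h2 := edges_add_edges_compl (G := G) {x, y} {x, y}
    rw [Finset.sum_pair (ne_of_mult_pos hxy)] at h2
    omega
  obtain ⟨h, h1, h2, h3⟩ := exists_stars hlow
  have hfib : ∀ a, (pre h {a}).Nonempty → G.Conn (pre h {a}) := by
    rintro a ⟨z, hz⟩
    rw [mem_pre, Finset.mem_singleton] at hz
    have ha : h a = a := by
      by_cases hza : z ∈ G.active
      · exact hz ▸ h1 _ (h3 z hza).1
      · rw [h2 z hza] at hz
        exact hz ▸ h2 z hza
    have haa : a ∈ pre h {a} := by simp [mem_pre, ha]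
    refine conn_of_root haa fun x hx => ?_
    have hx' := hx
    rw [mem_pre, Finset.mem_singleton] at hx'
    by_cases hxa : x ∈ G.active
    · rcases (h3 x hxa).2 with h4 | ⟨h4, -⟩
      · rw [h4] at hx'
        subst hx'
        exact .refl
      · rw [hx'] at h4
        exact .single ⟨haa, hx, h4⟩
    · rw [h2 x hxa] at hx'
      subst hx'
      exact .refl
  have hQactive : ∀ a ∈ (G.quot h).active, highDeg r ≤ G.deg a := by
    intro a ha
    obtain ⟨b, hb⟩ := mem_active.1 ha
    obtain ⟨-, x, y, rfl, -, hxy⟩ := quot_mult_pos.1 hb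
    exact (h3 x (mem_active_left hxy)).1
  have hQdeg : ∀ a, highDeg r ≤ G.deg a → (r + 1) * (r - 1) ≤ (G.quot h).deg a := by
    intro a ha
    have := ha.trans (le_deg_quot_stars hr hm hlow (fun u v huv _ => htwo u v huv) h1 (h1 a ha))
    exact Nat.le_of_mul_le_mul_left this (by omega)
  refine Packing.of_quot (by omega) (packing_of_deg hr hρ
    (hns.quot_stars (by omega) hlow h1 h3) ?_ fun v hv => hQdeg v (hQactive v hv)) hfib
  obtain ⟨x, hx⟩ := hne
  refine ⟨h x, mem_active_iff_deg_pos.2 (lt_of_lt_of_le ?_ (hQdeg _ (h3 x hx).1))⟩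
  exact Nat.mul_pos (by omega) (by omega)

/-- A highly tangled multigraph contains many disjoint models. -/
theorem Tangled.packing {r K ρ n : ℕ} (hr : 2 ≤ r) (hρ : 2 * (K * (r + 2)) ≤ 2 ^ ρ) (j : ℕ)
    (hj : j ≤ K) (G : Multigraph V) (p : V → ℕ) {m : ℕ}
    (hm : j * (2 * highDeg r * (2 * (2 + 4 * ρ * r) + r)) + 2 * (2 * highDeg r) < m)
    (hT : G.Tangled p n (2 * highDeg r) m) : G.Packing j r := by
  induction j generalizing G p m with
  | zero => exact packing_zero r
  | succ j ihj =>
    induction hN : G.active.card using Nat.strong_induction_on generalizing G p with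
    | _ N ih =>
      -- Contractions keep `j` and `m` and reduce the active vertices; deleting a small model passes
      -- to `j - 1`. The spare `2 * (2 * highDeg r)` in `hm` keeps pairs of vertices light. An
      -- irreducible multigraph yields all `K` models at once, so `ρ` depends on `K` and not on `j`.
      by_cases hns : G.NoSmallModel r (2 * (2 + 4 * ρ * r) + r)
      · by_cases hout : ∀ u v, 0 < G.mult u v → 2 * highDeg r < G.edges {u, v} {u, v}ᶜ
        · by_cases htwo : ∀ u v, 0 < G.mult u v → ∃ z ≠ u, 0 < G.mult v z
          · exact (packing_of_irreducible hr hρ hns (hT.exists_adj (by omega)) hout htwo).mono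
              hj le_rfl
          · push Not at htwo
            obtain ⟨u, v, huv, hz⟩ := htwo
            refine Packing.of_contract (by omega) huv (ih _ ?_ _ _
              (hT.contract_of_unique (u := u) (v := v) (by omega) ?_) rfl)
            · exact hN ▸ Finset.card_lt_card (active_quot_update_ssubset huv)
            · intro x hx
              by_contra hxu
              exact absurd (hz x hxu) (by omega)
        · push Not at hout
          obtain ⟨u, v, huv, he⟩ := hout
          refine Packing.of_contract (by omega) huv (ih _ ?_ _ _
            (hT.contract_of_edges_le (u := u) (v := v) (ne_of_mult_pos huv) (by omega) he) rfl)
          exact hN ▸ Finset.card_lt_card (active_quot_update_ssubset huv)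
      · simp only [NoSmallModel, not_forall, not_lt] at hns
        obtain ⟨P, Q, hP, hQ, hPQ, hc, he⟩ := hns
        have hc' : (P ∪ Q).card ≤ 2 * (2 + 4 * ρ * r) + r := (Finset.card_union_le P Q).trans hc
        have hc'' := Nat.mul_le_mul_left (2 * highDeg r) hc'
        rw [add_mul, one_mul] at hm
        obtain ⟨p', hp'⟩ := hT.del (M := P ∪ Q) (m' := m - 2 * highDeg r * (P ∪ Q).card) (by omega)
        exact Packing.of_del (by omega) hP hQ hPQ he (ihj (by omega) _ _ (by omega) hp')

end

end Multigraph

/-! ### Trees from parent functions -/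

/-- The graph on `Fin N` in which every `i > 0` is joined to `par i`. -/
def parentGraph (N : ℕ) (par : ℕ → ℕ) : SimpleGraph (Fin N) where
  Adj i j := (j < i ∧ par i = j) ∨ (i < j ∧ par j = i)
  symm := ⟨fun _ _ h => h.symm⟩
  loopless := ⟨fun i h => by simp at h⟩

theorem parentGraph_induce_connected {N : ℕ} {par : ℕ → ℕ} {S : Set (Fin N)} {r : Fin N}
    (hr : r ∈ S) (hS : ∀ t ∈ S, t ≠ r → ∃ s ∈ S, s < t ∧ par t = s) :
    ((parentGraph N par).induce S).Connected := by
  rw [SimpleGraph.connected_iff_exists_forall_reachable]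
  refine ⟨⟨r, hr⟩, ?_⟩
  rintro ⟨t, ht⟩
  induction t using WellFoundedLT.induction with
  | _ t ih =>
    by_cases htr : t = r
    · subst htr; exact SimpleGraph.Reachable.refl _
    · obtain ⟨s, hs, hst, hpar⟩ := hS t ht htr
      refine (ih s hst hs).trans (SimpleGraph.Adj.reachable ?_)
      exact Or.inr ⟨hst, hpar⟩

theorem parentGraph_isTree {N : ℕ} {par : ℕ → ℕ} (hN : 0 < N)
    (hpar : ∀ i, 0 < i → i < N → par i < i) : (parentGraph N par).IsTree := by
  have hconn : (parentGraph N par).Connected := by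
    have := parentGraph_induce_connected (N := N) (par := par) (S := Set.univ) (r := ⟨0, hN⟩)
      trivial (fun t _ ht => by
        have ht0 : 0 < (t : ℕ) := Nat.pos_of_ne_zero fun h => ht (Fin.ext h)
        have := hpar t ht0 t.2
        exact ⟨⟨par t, this.trans t.2⟩, trivial, this, rfl⟩)
    exact (SimpleGraph.induceUnivIso _).connected_iff.1 this
  rw [SimpleGraph.isTree_iff_connected_and_card]
  refine ⟨hconn, le_antisymm ?_ hconn.card_vert_le_card_edgeSet_add_one⟩
  -- Each edge is determined by its larger end, which is not the root, so there are at most `N - 1`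
  -- edges.
  have hsub : (parentGraph N par).edgeSet ⊆
      (fun i : Fin N => s(i, if h : par i < N then ⟨par i, h⟩ else i)) '' {⟨0, hN⟩}ᶜ := by
    intro e he
    induction e with
    | _ i j =>
      have key : ∀ i j : Fin N, j < i → par i = j → s(i, j) ∈
          (fun i : Fin N => s(i, if h : par i < N then ⟨par i, h⟩ else i)) '' {⟨0, hN⟩}ᶜ := by
        intro i j hji hp
        refine ⟨i, ?_, ?_⟩
        · rintro rfl
          exact absurd (Fin.lt_def.1 hji) (Nat.not_lt_zero _)
        · simp [hp]
      rcases (SimpleGraph.mem_edgeSet _).1 he with ⟨h1, h2⟩ | ⟨h1, h2⟩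
      · exact key i j h1 h2
      · rw [Sym2.eq_swap]; exact key j i h1 h2
  have h1 := Set.ncard_le_ncard hsub (Set.toFinite _)
  have h2 := Set.ncard_image_le
    (f := fun i : Fin N => s(i, if h : par i < N then ⟨par i, h⟩ else i))
    (s := {⟨0, hN⟩}ᶜ) (Set.toFinite _)
  have h3 := Set.ncard_add_ncard_compl ({⟨0, hN⟩} : Set (Fin N))
  rw [Set.ncard_singleton] at h3
  rw [_root_.Nat.card_coe_set_eq]
  omega

/-! ### Balanced separators: bag sequences or a tangled multigraph -/

namespace Multigraph

section

set_option linter.unusedSectionVars false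

open scoped Classical

variable {V : Type*} [Fintype V] [DecidableEq V] (G : Multigraph V)

/-- The neighbourhood of a vertex set. -/
noncomputable def nbhd (D : Finset V) : Finset V :=
  Finset.univ.filter fun y => y ∉ D ∧ ∃ x ∈ D, 0 < G.mult x y

/-- Bags `0, …, N - 1` of size at most `k`, where each new bag meets the union of the previous ones
within its parent, form a tree-decomposition of the subgraph induced by the complement of `U`. -/
structure IsBagSequence (N : ℕ) (bag : ℕ → Finset V) (par : ℕ → ℕ) (k : ℕ) (U : Finset V) :
    Prop where
  pos : 0 < N
  par_lt : ∀ i, 0 < i → i < N → par i < i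
  inter_subset : ∀ i < N, ∀ j < i, bag i ∩ bag j ⊆ bag (par i)
  card_le : ∀ i < N, (bag i).card ≤ k
  notMem_iff : ∀ x, x ∉ U ↔ ∃ i < N, x ∈ bag i
  edge : ∀ x y, 0 < G.mult x y → x ∉ U → y ∉ U → ∃ i < N, x ∈ bag i ∧ y ∈ bag i

variable {G}

theorem mem_nbhd {D : Finset V} {y : V} : y ∈ G.nbhd D ↔ y ∉ D ∧ ∃ x ∈ D, 0 < G.mult x y := by
  simp [nbhd]

theorem exists_component {U : Finset V} {u : V} (hu : u ∈ U) : ∃ D ⊆ U, u ∈ D ∧ G.Conn D ∧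
    ∀ x ∈ D, ∀ y ∈ U, 0 < G.mult x y → y ∈ D := by
  obtain ⟨D, hD, hmax⟩ := Finset.exists_max_image
    (U.powerset.filter fun D => u ∈ D ∧ G.Conn D) Finset.card
    ⟨{u}, by simp [hu, conn_singleton]⟩
  rw [Finset.mem_filter, Finset.mem_powerset] at hD
  obtain ⟨hDU, huD, hDc⟩ := hD
  refine ⟨D, hDU, huD, hDc, fun x hx y hy hxy => ?_⟩
  by_contra hyD
  have := hmax (insert y D) (by
    rw [Finset.mem_filter, Finset.mem_powerset]
    exact ⟨Finset.insert_subset hy hDU, Finset.mem_insert_of_mem huD, hDc.insert hx hxy⟩)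
  rw [Finset.card_insert_of_notMem hyD] at this
  omega

theorem Conn.subset_of_closed {D' U D : Finset V} (hD' : G.Conn D') (hU : D' ⊆ U)
    (hD : ∀ x ∈ D, ∀ y ∈ U, 0 < G.mult x y → y ∈ D) {z : V} (hz : z ∈ D') (hzD : z ∈ D) :
    D' ⊆ D := by
  by_contra hcon
  obtain ⟨x, hx, y, hy, hyn, hxy⟩ := hD'.exists_edge (A := D' ∩ D) Finset.inter_subset_left
    ⟨z, Finset.mem_inter.2 ⟨hz, hzD⟩⟩ (fun h => hcon (Finset.inter_eq_left.1 h))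
  exact hyn (Finset.mem_inter.2 ⟨hy, hD x (Finset.mem_inter.1 hx).2 y (hU hy) hxy⟩)

/-- Bags are added until the uncovered set `U` is empty, keeping the neighbourhood of each component
of `U` inside one bag and of size less than `2 * m`. -/
theorem exists_bagSequence {m : ℕ}
    (hsep : ∀ W : Finset V, W.card ≤ 2 * m → ∃ X : Finset V, X.card < m ∧
      ∀ C, G.Conn C → Disjoint C X → 2 * (C ∩ W).card ≤ W.card)
    (U : Finset V) (N : ℕ) (bag : ℕ → Finset V) (par : ℕ → ℕ)
    (hseq : G.IsBagSequence N bag par (3 * m - 1) U)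
    (hU : ∀ D ⊆ U, G.Conn D → (∀ x ∈ D, ∀ y ∈ U, 0 < G.mult x y → y ∈ D) →
      ∃ i < N, G.nbhd D ⊆ bag i ∧ (G.nbhd D).card + 1 ≤ 2 * m) :
    ∃ N bag par, G.IsBagSequence N bag par (3 * m - 1) ∅ := by
  induction hn : U.card using Nat.strong_induction_on generalizing U N bag par with
  | _ n ih =>
    subst hn
    rcases U.eq_empty_or_nonempty with rfl | ⟨u, hu⟩
    · exact ⟨N, bag, par, hseq⟩
    obtain ⟨D, hDU, huD, hDc, hDcl⟩ := exists_component (G := G) hu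
    obtain ⟨i, hiN, hZi, hZc⟩ := hU D hDU hDc hDcl
    set Z := G.nbhd D with hZ
    have hZU : ∀ z ∈ Z, z ∉ U := by
      intro z hz hzU
      obtain ⟨hzD, x, hx, hxz⟩ := mem_nbhd.1 hz
      exact hzD (hDcl x hx z hzU hxz)
    obtain ⟨X, hXm, hX⟩ := hsep (insert u Z) ((Finset.card_insert_le _ _).trans hZc)
    set W := insert u Z with hW
    have hWc : W.card ≤ 2 * m := (Finset.card_insert_le _ _).trans hZc
    -- The new bag has at most `2 * m + (m - 1)` vertices. It contains `u`, so `U` shrinks, and it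
    -- meets the older bags only within `Z ⊆ bag i`.
    set B := (W ∪ X) ∩ (D ∪ Z) with hB
    have hZB : Z ⊆ B := fun z hz => Finset.mem_inter.2
      ⟨Finset.mem_union_left _ (Finset.mem_insert_of_mem hz), Finset.mem_union_right _ hz⟩
    have huB : u ∈ B := Finset.mem_inter.2
      ⟨Finset.mem_union_left _ (Finset.mem_insert_self _ _), Finset.mem_union_left _ huD⟩
    have hBU : ∀ x ∈ B, x ∈ U → x ∈ D := by
      intro x hx hxU
      rcases Finset.mem_union.1 (Finset.mem_inter.1 hx).2 with h | h
      · exact h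
      · exact (hZU x h hxU).elim
    have hbag : ∀ j < N, Function.update bag N B j = bag j := fun j hj =>
      Function.update_of_ne hj.ne _ _
    have hseq' : G.IsBagSequence (N + 1) (Function.update bag N B) (Function.update par N i)
        (3 * m - 1) (U \ B) := by
      refine ⟨Nat.succ_pos N, fun j hj hjN => ?_, fun j hjN l hl => ?_, fun j hjN => ?_,
        fun x => ?_, fun x y hxy hx hy => ?_⟩
      · rcases Nat.lt_succ_iff_lt_or_eq.1 hjN with h | rfl
        · rw [Function.update_of_ne h.ne]; exact hseq.par_lt j hj h
        · rwa [Function.update_self]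
      · rcases Nat.lt_succ_iff_lt_or_eq.1 hjN with h | rfl
        · rw [Function.update_of_ne h.ne, Function.update_of_ne h.ne,
            Function.update_of_ne (hl.trans h).ne, Function.update_of_ne]
          · exact hseq.inter_subset j h l hl
          · exact ((hseq.par_lt j (by omega) h).trans h).ne
        · rw [Function.update_self, Function.update_self, hbag l hl, hbag i hiN]
          intro x hx
          obtain ⟨hxB, hxl⟩ := Finset.mem_inter.1 hx
          have hxU : x ∉ U := (hseq.notMem_iff x).2 ⟨l, hl, hxl⟩
          rcases Finset.mem_union.1 (Finset.mem_inter.1 hxB).2 with h | h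
          · exact (hxU (hDU h)).elim
          · exact hZi h
      · rcases Nat.lt_succ_iff_lt_or_eq.1 hjN with h | rfl
        · rw [hbag j h]; exact hseq.card_le j h
        · rw [Function.update_self]
          have h1 : B.card ≤ (W ∪ X).card := Finset.card_le_card Finset.inter_subset_left
          have h2 := Finset.card_union_le W X
          omega
      · rw [Finset.mem_sdiff, not_and_or, not_not, hseq.notMem_iff x]
        constructor
        · rintro (⟨j, hj, hx⟩ | hx)
          · exact ⟨j, hj.trans (Nat.lt_succ_self N), by rwa [hbag j hj]⟩
          · exact ⟨N, Nat.lt_succ_self N, by rwa [Function.update_self]⟩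
        · rintro ⟨j, hj, hx⟩
          rcases Nat.lt_succ_iff_lt_or_eq.1 hj with h | rfl
          · exact .inl ⟨j, h, by rwa [hbag j h] at hx⟩
          · exact .inr (by rwa [Function.update_self] at hx)
      · rw [Finset.mem_sdiff, not_and_or, not_not] at hx hy
        have key : ∀ x y, 0 < G.mult x y → x ∈ D → x ∈ B → (y ∉ U ∨ y ∈ B) → y ∈ B := by
          intro x y hxy hxD hxB hy
          refine hy.elim (fun hy => hZB (mem_nbhd.2 ⟨fun h => hy (hDU h), x, hxD, hxy⟩)) id
        by_cases hxU : x ∈ U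
        · have hxB := hx.resolve_left (not_not.2 hxU)
          refine ⟨N, Nat.lt_succ_self N, ?_⟩
          rw [Function.update_self]
          exact ⟨hxB, key x y hxy (hBU x hxB hxU) hxB hy⟩
        · by_cases hyU : y ∈ U
          · have hyB := hy.resolve_left (not_not.2 hyU)
            refine ⟨N, Nat.lt_succ_self N, ?_⟩
            rw [Function.update_self]
            exact ⟨key y x (G.symm x y ▸ hxy) (hBU y hyB hyU) hyB hx, hyB⟩
          · obtain ⟨j, hj, h⟩ := hseq.edge x y hxy hxU hyU
            exact ⟨j, hj.trans (Nat.lt_succ_self N), by rwa [hbag j hj]⟩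
    refine ih _ (Finset.card_lt_card ((Finset.ssubset_iff_of_subset Finset.sdiff_subset).2
      ⟨u, hu, by simp [huB]⟩)) (U \ B) _ _ _ hseq' ?_ rfl
    intro D' hD'U hD' hD'cl
    by_cases hmeet : ∃ z ∈ D', z ∈ D
    · obtain ⟨z, hz, hzD⟩ := hmeet
      have hD'D := hD'.subset_of_closed (hD'U.trans Finset.sdiff_subset) hDcl hz hzD
      have hnB : G.nbhd D' ⊆ B := by
        intro y hy
        obtain ⟨hyD', x, hx, hxy⟩ := mem_nbhd.1 hy
        by_cases hyD : y ∈ D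
        · by_contra hyB
          exact hyD' (hD'cl x hx y (Finset.mem_sdiff.2 ⟨hDU hyD, hyB⟩) hxy)
        · exact hZB (mem_nbhd.2 ⟨hyD, x, hD'D hx, hxy⟩)
      refine ⟨N, Nat.lt_succ_self N, by rwa [Function.update_self], ?_⟩
      -- This connected set avoids `X`, so it contains at most half of `W`. Hence `D'` has at most
      -- `m` neighbours outside `X` and at most `m - 1` in `X`.
      have hCc : G.Conn (D' ∪ (G.nbhd D' \ X)) := by
        refine conn_of_root (Finset.mem_union_left _ hz) fun y hy => ?_
        rcases Finset.mem_union.1 hy with h | h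
        · exact reflTransGen_mono Finset.subset_union_left (hD'.2 z hz y h)
        · obtain ⟨-, x, hx, hxy⟩ := mem_nbhd.1 (Finset.mem_sdiff.1 h).1
          exact .tail (reflTransGen_mono Finset.subset_union_left (hD'.2 z hz x hx))
            ⟨Finset.mem_union_left _ hx, hy, hxy⟩
      have h1 := hX _ hCc (by
        rw [Finset.disjoint_union_left]
        refine ⟨Finset.disjoint_left.2 fun x hx hxX => ?_, Finset.sdiff_disjoint⟩
        exact (Finset.mem_sdiff.1 (hD'U hx)).2 (Finset.mem_inter.2
          ⟨Finset.mem_union_right _ hxX, Finset.mem_union_left _ (hD'D hx)⟩))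
      have h2 : G.nbhd D' ⊆ ((D' ∪ (G.nbhd D' \ X)) ∩ W) ∪ X := by
        intro y hy
        by_cases hyX : y ∈ X
        · exact Finset.mem_union_right _ hyX
        · refine Finset.mem_union_left _ (Finset.mem_inter.2 ⟨Finset.mem_union_right _
            (Finset.mem_sdiff.2 ⟨hy, hyX⟩), ?_⟩)
          exact (Finset.mem_union.1 (Finset.mem_inter.1 (hnB hy)).1).resolve_right hyX
      have h3 := (Finset.card_le_card h2).trans (Finset.card_union_le _ _)
      omega
    · push Not at hmeet
      obtain ⟨j, hj, hj1, hj2⟩ := hU D' (hD'U.trans Finset.sdiff_subset) hD' (by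
        intro x hx y hy hxy
        refine hD'cl x hx y (Finset.mem_sdiff.2 ⟨hy, fun hyB => ?_⟩) hxy
        exact hmeet x hx (hDcl y (hBU y hyB hy) x (Finset.mem_sdiff.1 (hD'U hx)).1
          (G.symm x y ▸ hxy)))
      exact ⟨j, hj.trans (Nat.lt_succ_self N), by rwa [hbag j hj], hj2⟩

/-- Replace each cut edge by its end of smaller colour. As `1 ≤ t`, this gives fewer than `m`
vertices, and a connected set avoiding them is monochromatic. -/
theorem tangled_of_no_separator {m t : ℕ} (ht : 1 ≤ t) {W : Finset V}
    (hW : ∀ X : Finset V, X.card < m → ∃ C, G.Conn C ∧ Disjoint C X ∧ W.card < 2 * (C ∩ W).card) :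
    G.Tangled (fun x => if x ∈ W then 1 else 0) W.card t m := by
  refine ⟨by simp, fun S c hc => ?_⟩
  set Y := Finset.univ.filter fun x => x ∉ S ∧ ∃ y, y ∉ S ∧ c x < c y ∧ 0 < G.mult x y with hY
  have hcut : 2 * Y.card ≤ G.cut S c := by
    have h1 : G.cut S c = ∑ x, ∑ y, (if x ∉ S ∧ y ∉ S ∧ c x < c y then 1 else 0) * G.mult x y +
        ∑ x, ∑ y, (if x ∉ S ∧ y ∉ S ∧ c y < c x then 1 else 0) * G.mult x y := by
      simp only [cut, ← Finset.sum_add_distrib, ← add_mul]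
      refine Finset.sum_congr rfl fun x _ => Finset.sum_congr rfl fun y _ => ?_
      congr 1
      rcases lt_trichotomy (c x) (c y) with h | h | h
      · simp [h, h.ne, h.not_gt]
      · simp [h]
      · simp [h, h.ne', h.not_gt]
    have h2 : ∑ x, ∑ y, (if x ∉ S ∧ y ∉ S ∧ c y < c x then 1 else 0) * G.mult x y =
        ∑ x, ∑ y, (if x ∉ S ∧ y ∉ S ∧ c x < c y then 1 else 0) * G.mult x y := by
      rw [Finset.sum_comm]
      refine Finset.sum_congr rfl fun x _ => Finset.sum_congr rfl fun y _ => ?_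
      simp only [G.symm x y, and_left_comm]
    rw [h1, h2, ← two_mul, hY, Finset.card_filter]
    refine Nat.mul_le_mul_left _ (Finset.sum_le_sum fun x _ => ?_)
    split_ifs with h
    · obtain ⟨hx, y, hy, hxy, hpos⟩ := h
      refine le_trans ?_ (Finset.single_le_sum (fun _ _ => Nat.zero_le _) (Finset.mem_univ y))
      simpa [hx, hy, hxy] using Nat.succ_le_of_lt hpos
    · exact Nat.zero_le _
  obtain ⟨C, hC, hCX, hCW⟩ := hW (S ∪ Y) (by
    have h1 := Finset.card_union_le S Y
    have h2 : S.card ≤ t * S.card := Nat.le_mul_of_pos_left _ ht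
    omega)
  rw [Finset.disjoint_union_right] at hCX
  obtain ⟨z, hz⟩ := hC.1
  have hCS : ∀ x ∈ C, x ∉ S := fun x hx => Finset.disjoint_left.1 hCX.1 hx
  have hmono : ∀ x ∈ C, ∀ y ∈ C, 0 < G.mult x y → ¬ c x < c y := fun x hx y hy hxy hlt =>
    Finset.disjoint_left.1 hCX.2 hx
      (Finset.mem_filter.2 ⟨Finset.mem_univ _, hCS x hx, y, hCS y hy, hlt, hxy⟩)
  have hcol : ∀ x ∈ C, c x = c z := by
    intro x hx
    induction hC.2 z hz x hx with
    | refl => rfl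
    | @tail a b _ hab ih =>
      have h1 := hmono a hab.1 b hab.2.1 hab.2.2
      have h2 := hmono b hab.2.1 a hab.1 (G.symm a b ▸ hab.2.2)
      have := ih hab.1
      omega
  refine ⟨c z, hCW.trans_le (Nat.mul_le_mul_left _ ?_)⟩
  rw [Finset.card_eq_sum_ones, classWeight, ← Finset.filter_mem_eq_inter, Finset.sum_filter]
  refine (Finset.sum_le_sum_of_subset (Finset.subset_univ C)).trans' ?_
  refine Finset.sum_le_sum fun x hx => ?_
  simp [hCS x hx, hcol x hx]

end

end Multigraph

/-! ### Translation to and from graphs -/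

namespace Graph

section

open scoped Classical

variable {α β : Type*} [DecidableEq α] (G : Graph α β)

/-- The number of edges between distinct vertices. -/
noncomputable def toMultigraph : Multigraph G.vertexSet where
  mult x y := if x = y then 0 else {e | G.IsLink e x y}.ncard
  symm x y := by simp only [eq_comm (a := x), G.isLink_comm (x := (x : α))]
  diag x := by simp

variable {G}

theorem toMultigraph_mult {x y : G.vertexSet} (h : x ≠ y) :
    G.toMultigraph.mult x y = {e | G.IsLink e x y}.ncard := if_neg h

theorem adj_of_mult_pos {x y : G.vertexSet} (h : 0 < G.toMultigraph.mult x y) : G.Adj x y := by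
  have hne : x ≠ y := by rintro rfl; simp [toMultigraph] at h
  rw [toMultigraph_mult hne] at h
  obtain ⟨e, he⟩ := Set.nonempty_of_ncard_ne_zero h.ne'
  exact ⟨e, he⟩

omit [DecidableEq α] in
theorem isLink_finite (hE : G.edgeSet.Finite) (x y : α) : {e | G.IsLink e x y}.Finite :=
  hE.subset fun _ he => he.edge_mem

theorem mult_pos_of_isLink (hE : G.edgeSet.Finite) {e : β} {x y : G.vertexSet} (hxy : x ≠ y)
    (h : G.IsLink e x y) : 0 < G.toMultigraph.mult x y := by
  rw [toMultigraph_mult hxy, Set.ncard_pos (isLink_finite hE _ _)]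
  exact ⟨e, h⟩

theorem treewidth_le_of_bagSequence [Fintype G.vertexSet] (hE : G.edgeSet.Finite) {N k : ℕ}
    {bag : ℕ → Finset G.vertexSet} {par : ℕ → ℕ}
    (h : G.toMultigraph.IsBagSequence N bag par k ∅) : G.treewidth ≤ (k : ℤ) - 1 := by
  have hcov : ∀ x : G.vertexSet, ∃ i < N, x ∈ bag i := fun x =>
    (h.notMem_iff x).1 (Finset.notMem_empty x)
  let D : TreeDecomposition G (Fin N) :=
    { tree := parentGraph N par
      bag := fun t => (↑) '' (bag t : Set G.vertexSet)
      isTree := parentGraph_isTree h.pos h.par_lt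
      exists_bag_of_isLink := by
        intro e x y he
        by_cases hxy : x = y
        · subst hxy
          obtain ⟨i, hi, hx⟩ := hcov ⟨x, he.left_mem⟩
          have : x ∈ (↑) '' (bag i : Set G.vertexSet) := ⟨⟨x, he.left_mem⟩, hx, rfl⟩
          exact ⟨⟨i, hi⟩, this, this⟩
        · obtain ⟨i, hi, hx, hy⟩ := h.edge ⟨x, he.left_mem⟩ ⟨y, he.right_mem⟩
            (mult_pos_of_isLink hE (fun h => hxy (congrArg Subtype.val h)) he)
            (Finset.notMem_empty _) (Finset.notMem_empty _)
          exact ⟨⟨i, hi⟩, ⟨_, hx, rfl⟩, ⟨_, hy, rfl⟩⟩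
      connected := by
        intro u hu
        have hmem : ∀ t : Fin N, u ∈ (↑) '' (bag t : Set G.vertexSet) ↔ ⟨u, hu⟩ ∈ bag t := by
          intro t
          constructor
          · rintro ⟨x, hx, rfl⟩; exact hx
          · exact fun hx => ⟨_, hx, rfl⟩
        have hex := hcov ⟨u, hu⟩
        -- The first bag containing `u` is the root of its subtree: any later bag containing `u`
        -- passes it to its parent.
        have hfirst := Nat.find_spec hex
        refine parentGraph_induce_connected (r := ⟨Nat.find hex, hfirst.1⟩)
          ((hmem _).2 hfirst.2) fun t ht htr => ?_
        have ht' := (hmem t).1 ht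
        have hlt : Nat.find hex < t := lt_of_le_of_ne (Nat.find_min' hex ⟨t.2, ht'⟩)
          fun heq => htr (Fin.ext heq.symm)
        have hpar := h.par_lt t (by omega) t.2
        refine ⟨⟨par t, hpar.trans t.2⟩, (hmem _).2 ?_, hpar, rfl⟩
        exact h.inter_subset t t.2 _ hlt (Finset.mem_inter.2 ⟨ht', hfirst.2⟩)
      iUnion_bag := by
        ext x
        simp only [Set.mem_iUnion]
        constructor
        · rintro ⟨t, y, -, rfl⟩; exact y.2
        · intro hx
          obtain ⟨i, hi, hxi⟩ := hcov ⟨x, hx⟩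
          exact ⟨⟨i, hi⟩, ⟨x, hx⟩, hxi, rfl⟩ }
  have hw : D.width ≤ (k : ℤ) - 1 := by
    have : (Finset.univ.sup fun t => (D.bag t).ncard) ≤ k := by
      refine Finset.sup_le fun t _ => ?_
      refine (Set.ncard_image_le (Set.toFinite _)).trans ?_
      rw [Set.ncard_coe_finset]
      exact h.card_le t t.2
    unfold TreeDecomposition.width
    omega
  refine le_trans (csInf_le ⟨-1, ?_⟩ ⟨Fin N, inferInstance, D, rfl⟩) hw
  rintro w ⟨ι, _, D', rfl⟩
  unfold TreeDecomposition.width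
  omega

/-- Large treewidth yields a tangled multigraph. -/
theorem exists_tangled_of_le_treewidth [Fintype G.vertexSet] (hE : G.edgeSet.Finite) {m t : ℕ}
    (hm : 0 < m) (ht : 1 ≤ t) (h : (3 * m : ℤ) ≤ G.treewidth) :
    ∃ p n, G.toMultigraph.Tangled p n t m := by
  by_contra hcon
  push Not at hcon
  have hsep : ∀ W : Finset G.vertexSet, W.card ≤ 2 * m → ∃ X : Finset G.vertexSet, X.card < m ∧
      ∀ C, G.toMultigraph.Conn C → Disjoint C X → 2 * (C ∩ W).card ≤ W.card := by
    intro W _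
    by_contra! hX
    exact hcon _ _ (Multigraph.tangled_of_no_separator ht hX)
  obtain ⟨N, bag, par, hseq⟩ := Multigraph.exists_bagSequence hsep Finset.univ 1 (fun _ => ∅)
    (fun _ => 0)
    { pos := one_pos
      par_lt := fun i hi hi' => by omega
      inter_subset := by simp
      card_le := by simp
      notMem_iff := by simp
      edge := by simp } (by
        intro D _ _ hDcl
        have : G.toMultigraph.nbhd D = ∅ := by
          rw [Finset.eq_empty_iff_forall_notMem]
          intro y hy
          obtain ⟨hyD, x, hx, hxy⟩ := Multigraph.mem_nbhd.1 hy
          exact hyD (hDcl x hx y (Finset.mem_univ _) hxy)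
        refine ⟨0, one_pos, by simp [this], ?_⟩
        rw [this, Finset.card_empty]
        omega)
  have := treewidth_le_of_bagSequence hE hseq
  push_cast [Nat.cast_sub (show 1 ≤ 3 * m by omega)] at this
  omega

theorem isMinor_of_packing [Fintype G.vertexSet] (hE : G.edgeSet.Finite) {k r : ℕ}
    (h : G.toMultigraph.Packing k r) : (copies k (theta r)).IsMinor G := by
  obtain ⟨B, hB, hdisj, hedge⟩ := h
  have hset : ∀ i, ∃ f : Fin r → β, Function.Injective f ∧ ∀ l,
      ∃ x ∈ B (i, false), ∃ y ∈ B (i, true), G.IsLink (f l) x y := by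
    intro i
    set S : Finset (G.vertexSet × G.vertexSet) := B (i, false) ×ˢ B (i, true) with hS
    let E : G.vertexSet × G.vertexSet → Finset β := fun q => (isLink_finite hE q.1 q.2).toFinset
    have hne : ∀ q ∈ S, q.1 ≠ q.2 := by
      intro q hq heq
      obtain ⟨h1, h2⟩ := Finset.mem_product.1 hq
      exact Finset.disjoint_left.1 (hdisj (i, false) (i, true) (by simp)) h1 (heq ▸ h2)
    -- The branch sets are disjoint, so distinct pairs carry disjoint edge sets and multiplicities
    -- add up to distinct edges.
    have hcard : r ≤ (S.biUnion E).card := by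
      rw [Finset.card_biUnion]
      · refine (hedge i).trans_eq ?_
        rw [Multigraph.edges, ← Finset.sum_product']
        refine Finset.sum_congr rfl fun q hq => ?_
        rw [toMultigraph_mult (hne q hq), Set.ncard_eq_toFinset_card _ (isLink_finite hE _ _)]
      · intro q hq q' hq' hqq
        rw [Function.onFun, Finset.disjoint_left]
        intro e he he'
        simp only [E, Set.Finite.mem_toFinset, Set.mem_ofPred_eq] at he he'
        obtain ⟨h1, h2⟩ := Finset.mem_product.1 hq
        obtain ⟨h1', h2'⟩ := Finset.mem_product.1 hq'
        rcases he.eq_and_eq_or_eq_and_eq he' with ⟨h3, h4⟩ | ⟨h3, h4⟩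
        · exact hqq (Prod.ext (Subtype.ext h3) (Subtype.ext h4))
        · exact Finset.disjoint_left.1 (hdisj (i, false) (i, true) (by simp)) h1
            (Subtype.ext h3 ▸ h2')
    obtain ⟨T, hT, hTc⟩ := Finset.exists_subset_card_eq hcard
    refine ⟨fun l => (T.equivFin.symm (Fin.cast hTc.symm l) : β), ?_, fun l => ?_⟩
    · intro a b hab
      have := T.equivFin.symm.injective (Subtype.ext hab)
      exact Fin.cast_injective _ this
    · obtain ⟨q, hq, he⟩ := Finset.mem_biUnion.1 (hT (T.equivFin.symm (Fin.cast hTc.symm l)).2)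
      simp only [E, Set.Finite.mem_toFinset, Set.mem_ofPred_eq] at he
      obtain ⟨h1, h2⟩ := Finset.mem_product.1 hq
      exact ⟨q.1, h1, q.2, h2, he⟩
  choose f hf hlink using hset
  have hval : ∀ (v : Fin k × Bool) (x : α), x ∈ (↑) '' (B v : Set G.vertexSet) →
      ∃ hx : x ∈ G.vertexSet, (⟨x, hx⟩ : G.vertexSet) ∈ B v := by
    rintro v _ ⟨x, hx, rfl⟩
    exact ⟨x.2, hx⟩
  have heq : ∀ v w (x : G.vertexSet), x ∈ B v → x ∈ B w → v = w := by
    intro v w x hv hw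
    by_contra hvw
    exact Finset.disjoint_left.1 (hdisj v w hvw) hv hw
  refine ⟨fun v => G.induce ((↑) '' (B v : Set G.vertexSet)), fun e => f e.1.1 e.1.2,
    fun v _ => ⟨G.induce_le ?_, ?_, ?_⟩, fun v _ w _ hvw => ?_, ?_, ?_, ?_⟩
  · rintro _ ⟨x, -, rfl⟩; exact x.2
  · obtain ⟨x, hx⟩ := (hB v).1
    exact ⟨x, x, hx, rfl⟩
  · rintro _ ⟨x, hx, rfl⟩ _ ⟨y, hy, rfl⟩
    refine Relation.ReflTransGen.lift (fun a : G.vertexSet => (a : α)) (fun a b hab => ?_) _ _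
      ((hB v).2 x hx y hy)
    obtain ⟨e, he⟩ := adj_of_mult_pos hab.2.2
    exact ⟨e, he, ⟨a, hab.1, rfl⟩, ⟨b, hab.2.1, rfl⟩⟩
  · rw [Set.disjoint_left]
    intro x hx hx'
    obtain ⟨hxG, h1⟩ := hval v x hx
    obtain ⟨_, h2⟩ := hval w x hx'
    exact hvw (heq v w _ h1 h2)
  · rintro ⟨⟨i, l⟩, hil⟩ ⟨⟨j, l'⟩, hjl⟩ heq'
    dsimp only at heq'
    obtain ⟨x, hx, y, hy, hxy⟩ := hlink i l
    obtain ⟨x', hx', y', hy', hxy'⟩ := hlink j l'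
    rw [← heq'] at hxy'
    have hij : i = j := by
      rcases hxy.eq_and_eq_or_eq_and_eq hxy' with ⟨h3, -⟩ | ⟨h3, -⟩
      · have := heq _ _ x hx (Subtype.ext h3 ▸ hx')
        simpa using this
      · have := heq _ _ x hx (Subtype.ext h3 ▸ hy')
        simp at this
    subst hij
    have := hf i heq'
    subst this
    rfl
  · rintro ⟨⟨i, l⟩, hil⟩ v - ⟨a, b, hab, ha, hb⟩
    obtain ⟨_, ha⟩ := hval v a ha
    obtain ⟨_, hb⟩ := hval v b hb
    obtain ⟨x, hx, y, hy, hxy⟩ := hlink i l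
    have hxy' : ∃ z : G.vertexSet, z ∈ B v ∧ (z : α) = x := by
      rcases hxy.eq_and_eq_or_eq_and_eq hab with ⟨h3, -⟩ | ⟨h3, -⟩
      exacts [⟨_, ha, h3.symm⟩, ⟨_, hb, h3.symm⟩]
    have hyx' : ∃ z : G.vertexSet, z ∈ B v ∧ (z : α) = y := by
      rcases hxy.eq_and_eq_or_eq_and_eq hab with ⟨-, h3⟩ | ⟨-, h3⟩
      exacts [⟨_, hb, h3.symm⟩, ⟨_, ha, h3.symm⟩]
    obtain ⟨z, hz, hzx⟩ := hxy'
    obtain ⟨z', hz', hzy⟩ := hyx'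
    have h1 := heq _ _ x hx (Subtype.ext hzx ▸ hz)
    have h2 := heq _ _ y hy (Subtype.ext hzy ▸ hz')
    simpa using h1.trans h2.symm
  · rintro ⟨⟨i, l⟩, hil⟩ ⟨a, v⟩ ⟨b, w⟩ ⟨ha, hb, hvw⟩
    dsimp only at ha hb hvw
    subst ha
    obtain rfl : b = a := hb
    obtain ⟨x, hx, y, hy, hxy⟩ := hlink b l
    rw [theta, banana_isLink] at hvw
    rcases hvw.2 with ⟨rfl, rfl⟩ | ⟨rfl, rfl⟩
    · exact ⟨x, ⟨x, hx, rfl⟩, y, ⟨y, hy, rfl⟩, hxy⟩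
    · exact ⟨y, ⟨y, hy, rfl⟩, x, ⟨x, hx, rfl⟩, hxy.symm⟩

end

end Graph

/-! ### Constants and conclusion -/

/-- This is where `2 ^ (6 * r) = 64 ^ r` comes from: with `r = s + 2`, the left side is the factor
in front of `k * log k` in the required treewidth. -/
theorem three_mul_le_pow (s : ℕ) :
    3 * (2 * ((s + 1) * ((s + 3) * (s + 1))) * (4 + 8 * ((s + 2) * (s + 5)) + (s + 2)) +
      2 * (2 * ((s + 1) * ((s + 3) * (s + 1)))) + 1) ≤ 64 ^ (s + 2) := by
  induction s with
  | zero => norm_num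
  | succ s ih =>
    rw [pow_succ 64 (s + 2)]
    refine le_trans ?_ (Nat.mul_le_mul_right 64 ih)
    ring_nf
    nlinarith [Nat.zero_le s, Nat.zero_le (s ^ 2), Nat.zero_le (s ^ 3), Nat.zero_le (s ^ 4),
      Nat.zero_le (s ^ 5)]

theorem add_two_le_two_pow {r : ℕ} (hr : 2 ≤ r) : r + 2 ≤ 2 ^ r := by
  induction r, hr using Nat.le_induction with
  | base => norm_num
  | succ r _ ih => rw [pow_succ]; omega

theorem Graph.packing_of_le_treewidth {α β : Type*} {G : Graph α β} [Fintype G.vertexSet]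
    [DecidableEq α] (hE : G.edgeSet.Finite) {r k : ℕ} (hr : 2 ≤ r) (hk : 1 ≤ k)
    (h : (2 : ℝ) ^ (6 * r) * k * Real.logb 2 (k + 1) ≤ (G.treewidth : ℝ)) :
    G.toMultigraph.Packing k r := by
  set e := Nat.log 2 (k + 1) with he
  have he1 : 1 ≤ e := Nat.le_log_of_pow_le (by norm_num) (by omega)
  have hke : k + 1 < 2 ^ (e + 1) := Nat.lt_pow_succ_log_self (by norm_num) _
  have hlog : (e : ℝ) ≤ Real.logb 2 (k + 1) := by
    rw [Real.le_logb_iff_rpow_le (by norm_num) (by positivity), Real.rpow_natCast]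
    exact_mod_cast Nat.pow_log_le_self 2 (Nat.succ_ne_zero k)
  set ρ := r + 2 + e with hρ
  -- The summands of `ρ` account for `r + 2 ≤ 2 ^ r`, `k ≤ 2 ^ (e + 1)` and the factor `2`.
  have hρK : 2 * (k * (r + 2)) ≤ 2 ^ ρ := by
    have h1 := Nat.mul_le_mul (show k ≤ 2 ^ (e + 1) by omega) (add_two_le_two_pow hr)
    have h2 : 2 ^ ρ = 2 * (2 ^ (e + 1) * 2 ^ r) := by rw [hρ]; ring
    omega
  set t := 2 * Multigraph.highDeg r with ht
  set L := 2 * (2 + 4 * ρ * r) + r with hL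
  have ht1 : 1 ≤ t := by
    have : 0 < Multigraph.highDeg r :=
      Nat.mul_pos (by omega) (Nat.mul_pos (by omega) (by omega))
    omega
  have hmain : 3 * (k * (t * L) + 2 * t + 1) ≤ 64 ^ r * (k * e) := by
    have hLe : L ≤ (4 + 8 * (r * (r + 3)) + r) * e := by
      obtain ⟨e', he'⟩ := Nat.exists_eq_add_of_le he1
      rw [hL, hρ, he']
      nlinarith [Nat.zero_le (r * e'), Nat.zero_le (r * r * e')]
    have hke1 : 1 ≤ k * e := Nat.mul_pos hk he1
    have h1 : k * (t * L) ≤ t * (4 + 8 * (r * (r + 3)) + r) * (k * e) := by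
      calc k * (t * L) ≤ k * (t * ((4 + 8 * (r * (r + 3)) + r) * e)) := by gcongr
        _ = _ := by ring
    have h2 : 2 * t + 1 ≤ (2 * t + 1) * (k * e) := Nat.le_mul_of_pos_right _ hke1
    have h3 : 3 * (t * (4 + 8 * (r * (r + 3)) + r) + 2 * t + 1) ≤ 64 ^ r := by
      obtain ⟨s, rfl⟩ := Nat.exists_eq_add_of_le' hr
      exact three_mul_le_pow s
    calc 3 * (k * (t * L) + 2 * t + 1)
        ≤ 3 * (t * (4 + 8 * (r * (r + 3)) + r) + 2 * t + 1) * (k * e) := by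
          rw [mul_assoc 3]
          refine Nat.mul_le_mul_left 3 ?_
          rw [add_assoc, add_assoc, add_mul]
          exact add_le_add h1 h2
      _ ≤ 64 ^ r * (k * e) := Nat.mul_le_mul_right _ h3
  have htw : (3 * (k * (t * L) + 2 * t + 1 : ℕ) : ℤ) ≤ G.treewidth := by
    have h1 : ((3 * (k * (t * L) + 2 * t + 1) : ℕ) : ℝ) ≤ (G.treewidth : ℝ) := by
      calc ((3 * (k * (t * L) + 2 * t + 1) : ℕ) : ℝ) ≤ ((64 ^ r * (k * e) : ℕ) : ℝ) := by
            exact_mod_cast hmain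
        _ = (2 : ℝ) ^ (6 * r) * k * e := by
            push_cast
            rw [pow_mul]
            norm_num
            ring
        _ ≤ (2 : ℝ) ^ (6 * r) * k * Real.logb 2 (k + 1) := by gcongr
        _ ≤ _ := h
    have h2 : (((3 * (k * (t * L) + 2 * t + 1) : ℕ) : ℤ) : ℝ) ≤ (G.treewidth : ℝ) := by
      exact_mod_cast h1
    exact_mod_cast Int.cast_le.1 h2
  obtain ⟨p, n, hT⟩ := G.exists_tangled_of_le_treewidth hE (Nat.succ_pos _) ht1 htw
  exact hT.packing hr hρK k le_rfl _ _ (Nat.lt_succ_self _)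

theorem theorem5 :
    (∀ (α : Type*) (β : Type*) (G : Graph α β),
      G.vertexSet.Finite → G.edgeSet.Finite → G.Loopless →
      ∀ r k : ℕ, 2 ≤ r → 1 ≤ k →
        (2 : ℝ) ^ (6 * r) * k * Real.logb 2 (k + 1) ≤ (G.treewidth : ℝ) →
        (Graph.copies k (Graph.theta r)).IsMinor G) ∧
    (∀ r : ℕ, ∃ c : ℕ → ℝ,
      (c =O[Filter.atTop] fun k : ℕ => (k : ℝ) * Real.logb 2 k) ∧
      ∀ (k : ℕ) (α : Type*) (β : Type*) (G : Graph α β),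
        G.vertexSet.Finite → G.edgeSet.Finite → G.Loopless →
        ¬ (Graph.copies k (Graph.theta r)).IsMinor G →
        (G.treewidth : ℝ) ≤ c k) := by
  classical
  refine ⟨fun α β G hV hE _ r k hr hk h => ?_, fun r =>
    -- The first part needs `2 ≤ r`; smaller `r` follow from a packing for `max r 2`.
    ⟨fun k => (2 : ℝ) ^ (6 * max r 2) * k * Real.logb 2 (k + 1), ?_,
      fun k α β G hV hE _ hG => ?_⟩⟩
  · have := hV.fintype
    exact Graph.isMinor_of_packing hE (Graph.packing_of_le_treewidth hE hr hk h)
  · refine Asymptotics.IsBigO.of_bound ((2 : ℝ) ^ (6 * max r 2) * 2) ?_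
    filter_upwards [Filter.eventually_ge_atTop 2] with k hk
    have hk' : (2 : ℝ) ≤ k := by exact_mod_cast hk
    have h1 : 0 ≤ Real.logb 2 (k + 1) := Real.logb_nonneg (by norm_num) (by linarith)
    have h2 : 0 ≤ Real.logb 2 (k : ℝ) := Real.logb_nonneg (by norm_num) (by linarith)
    have h3 : Real.logb 2 ((k : ℝ) + 1) ≤ 2 * Real.logb 2 k := by
      calc Real.logb 2 ((k : ℝ) + 1) ≤ Real.logb 2 ((k : ℝ) ^ 2) :=
            Real.logb_le_logb_of_le (by norm_num) (by linarith) (by nlinarith)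
        _ = 2 * Real.logb 2 k := by rw [Real.logb_pow]; norm_num
    rw [Real.norm_of_nonneg (by positivity), Real.norm_of_nonneg (by positivity)]
    calc (2 : ℝ) ^ (6 * max r 2) * k * Real.logb 2 (k + 1)
        ≤ (2 : ℝ) ^ (6 * max r 2) * k * (2 * Real.logb 2 k) := by gcongr
      _ = _ := by ring
  · have := hV.fintype
    by_contra! hlt
    refine hG (Graph.isMinor_of_packing hE ?_)
    rcases Nat.eq_zero_or_pos k with rfl | hk
    · exact Multigraph.packing_zero r
    · exact (Graph.packing_of_le_treewidth hE (le_max_right r 2) hk hlt.le).mono le_rfl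
        (le_max_left r 2)
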